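/- Let $W\subset\mathbb R^2$ be a bounded convex set with non-empty interior. Lines of the plane are parametrised by $(\alpha,p)\in[0,\pi)\times\mathbb R$, the line $D(p,\alpha)$ being $\{x : x_1\cos\alpha+x_2\sin\alpha=p\}$. Let $D_W$ be the set of those $(\alpha,p)$ for which $D(p,\alpha)$ intersects $W$. For $\tau\ge 0$, let $\lambda_W^\tau$ be the law of the Poisson line process of intensity $\tau$ restricted to $W$: a random finite set of lines whose number of lines is a Poisson variable of parameter $\tau$ and which, given their number, are independent with the uniform distribution (normalised Lebesgue measure) on $D_W$. A T-tessellation $T$ of $W$ is a tessellation of $W$ into finitely many polygonal cells all of whose inner vertices are T-shaped and no two of whose segments are aligned. It is described by its segments: $T$ is a finite (possibly empty) set of non-degenerate closed segments, whose insides (the segments without their endpoints) lie in the interior of $W$, no two of which are supported by the same line, and such that every vertex $x$ in the interior of $W$ (every endpoint of a segment and every common point of two segments) belongs to the inside of exactly one segment and is an endpoint of exactly one segment. Denote by $L(T)$ the finite set of lines that support the segments of $T$, and by $\mathcal T_W$ the set of T-tessellations of $W$. Finite sets of lines and finite sets of segments carry the usual $\sigma$-algebra of finite point configurations (a set $S$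 of configurations is measurable if for every $k$ the set of $k$-tuples $(x_1,\dots,x_k)$ with $\{x_1,\dots,x_k\}\in S$ is Borel), and $\mathcal T_W$ carries the $\sigma$-algebra induced by the second one. Theorem. Let $C\in\mathbb R$ and let $H:\mathcal T_W\to\mathbb R$ be a measurable function (the energy) such that $H(T)\ge -C\,\#L(T)$ for every $T\in\mathcal T_W$. Then for every intensity $\tau\ge 0$ the Gibbs measure $$\mathrm d\gamma_W(T)=\exp(-H(T))\,\mathrm d\lambda_W^\tau(L(T))$$ on $\mathcal T_W$ is well-defined and finite. That is: the map sending a finite set of lines $L$ to the counting measure on $\{T\in\mathcal T_W: L(T)=L\}$ is $\lambda_W^\tau$-almost everywhere measurable, so that $$\gamma_W(A)=\int \sum_{T\in A,\ L(T)=L} e^{-H(T)}\;\mathrm d\lambda_W^\tau(L)\qquad (A\subseteq\mathcal T_W\text{ measurable})$$ defines a measure on $\mathcal T_W$, and $\gamma_W(\mathcal T_W)<\infty$. -/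

import Mathlib

open MeasureTheory
open scoped NNReal ENNReal

/-! ### Finite configurations of points -/

/-- A finite set of points of `α`. The wrapper only serves to carry the sigma-algebra of finite
point configurations given below, which differs from the sigma-algebra of `Finset α`. -/
@[ext]
structure FinConfig (α : Type*) where
  /-- the points of the configuration -/
  points : Finset α

namespace FinConfig

open Classical in
/-- The configuration `{x₁, …, x_k}` of the values of a `k`-tuple. -/
noncomputable def ofTuple {α : Type*} {k : ℕ} (x : Fin k → α) : FinConfig α :=
  ⟨Finset.univ.image x⟩

/-- The sigma-algebra of finite point configurations: a set `S` of configurations is measurable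
when, for every `k`, the set of `k`-tuples `(x₁, …, x_k)` with `{x₁, …, x_k} ∈ S` is measurable in
the product space `α^k`. -/
noncomputable instance instMeasurableSpace {α : Type*} [MeasurableSpace α] : MeasurableSpace (FinConfig α) :=
  ⨅ k : ℕ, MeasurableSpace.map (ofTuple (k := k)) MeasurableSpace.pi

theorem measurable_ofTuple {α : Type*} [MeasurableSpace α] (k : ℕ) :
    Measurable (ofTuple (α := α) (k := k)) := fun _ hS =>
  MeasurableSpace.measurableSet_iInf.1 hS k

end FinConfig

/-! ### Lines and the Poisson line process -/

/-- The Euclidean plane. -/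
abbrev Plane := EuclideanSpace ℝ (Fin 2)

/-- A pair `(α, p)` stands for the line `D(p, α)`, orthogonal at the point `P` of polar coordinates
`(p, α)` to the direction of angle `α`. Every line has exactly one such pair with `0 ≤ α < π`. -/
abbrev LineParam := ℝ × ℝ

/-- The point of abscissa `t` on the line `D(p, α)`, that is
`p (cos α, sin α) + t (-sin α, cos α)`. -/
noncomputable def linePoint (l : LineParam) (t : ℝ) : Plane :=
  !₂[l.2 * Real.cos l.1 - t * Real.sin l.1, l.2 * Real.sin l.1 + t * Real.cos l.1]

/-- The set `D_W ⊆ [0, π) × ℝ` of lines that intersect `W`. -/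
def hittingLines (W : Set Plane) : Set LineParam :=
  {l | l.1 ∈ Set.Ico 0 Real.pi ∧ ∃ t : ℝ, linePoint l t ∈ W}

/-- The law `λ_W^τ` of the Poisson line process restricted to `W`, where `τ` is the expected number
of lines: the number of lines is Poisson with parameter `τ`, and given that number the lines are
independent with the uniform law (normalised Lebesgue measure) on `D_W`. -/
noncomputable def poissonLines (W : Set Plane) (τ : ℝ≥0) : Measure (FinConfig LineParam) :=
  Measure.sum fun k : ℕ => ProbabilityTheory.poissonMeasure τ {k} •
    (Measure.pi fun _ : Fin k =>
      ProbabilityTheory.cond (volume : Measure LineParam) (hittingLines W)).map FinConfig.ofTuple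

/-! ### T-tessellations -/

/-- A pair `(l, (b, d))` stands for the segment of the line `l` between the abscissas `b`
and `d`. -/
abbrev SegParam := LineParam × ℝ × ℝ

namespace SegParam

/-- The closed segment. -/
def carrier (s : SegParam) : Set Plane := linePoint s.1 '' Set.Icc s.2.1 s.2.2

/-- The segment without its endpoints. -/
def inside (s : SegParam) : Set Plane := linePoint s.1 '' Set.Ioo s.2.1 s.2.2

/-- The two endpoints. -/
def ends (s : SegParam) : Set Plane := {linePoint s.1 s.2.1, linePoint s.1 s.2.2}

end SegParam

/-- `x` is a vertex of the drawing made of the segments in `S`: an endpoint of a segment or a common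
point of two segments. -/
def IsVertex (S : Finset SegParam) (x : Plane) : Prop :=
  (∃ s ∈ S, x ∈ s.ends) ∨ ∃ s ∈ S, ∃ m ∈ S, s ≠ m ∧ x ∈ s.carrier ∧ x ∈ m.carrier

/-- `x` is T-shaped: exactly one segment of `S` has `x` in its inside (it provides two aligned edges
at `x`) and exactly one segment of `S` ends at `x` (it provides the third edge). -/
def IsTShaped (S : Finset SegParam) (x : Plane) : Prop :=
  (∃! m : SegParam, m ∈ S ∧ x ∈ m.inside) ∧ ∃! s : SegParam, s ∈ S ∧ x ∈ s.ends

/-- A T-tessellation of a convex set `W`, given by its segments; the cells are the connected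
components of the complement of the segments in the interior of `W`. -/
@[ext]
structure TTessellation (W : Set Plane) where
  /-- the segments of the tessellation -/
  segments : Finset SegParam
  /-- every line is given by its parameters with angle in `[0, π)` -/
  angle_mem : ∀ s ∈ segments, s.1.1 ∈ Set.Ico 0 Real.pi
  /-- segments are nondegenerate -/
  birth_lt_death : ∀ s ∈ segments, s.2.1 < s.2.2
  /-- segments lie in the interior of `W`, except possibly for their endpoints -/
  inside_subset : ∀ s ∈ segments, s.inside ⊆ interior W
  /-- no two segments are aligned -/
  not_aligned : ∀ s ∈ segments, ∀ m ∈ segments, s.1 = m.1 → s = m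
  /-- all inner vertices are T-shaped -/
  tShaped : ∀ x ∈ interior W, IsVertex segments x → IsTShaped segments x

namespace TTessellation

variable {W : Set Plane}

open Classical in
/-- `L(T)`, the set of lines that support the segments of `T`. -/
noncomputable def lines (T : TTessellation W) : FinConfig LineParam :=
  ⟨T.segments.image Prod.fst⟩

/-- The sigma-algebra on T-tessellations, seen as finite configurations of segments. -/
noncomputable instance instMeasurableSpace : MeasurableSpace (TTessellation W) :=
  MeasurableSpace.comap (fun T => (⟨T.segments⟩ : FinConfig SegParam)) inferInstance

end TTessellation

/-- The counting measure on the T-tessellations `T` such that `L(T) = L`. -/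
noncomputable def tessellationsOn (W : Set Plane) (L : FinConfig LineParam) :
    Measure (TTessellation W) :=
  Measure.sum fun T : {T : TTessellation W // T.lines = L} => Measure.dirac T.1

/-- The reference measure `dλ_W^τ(L(T))` on T-tessellations:
`∫ F(T) dλ_W^τ(L(T)) = ∫ ∑_{T : L(T) = L} F(T) dλ_W^τ(L)`. -/
noncomputable def tessellationMeasure (W : Set Plane) (τ : ℝ≥0) : Measure (TTessellation W) :=
  (poissonLines W τ).bind (tessellationsOn W)

/-- The Gibbs measure `dγ_W(T) = exp(-H(T)) dλ_W^τ(L(T))`. -/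
noncomputable def gibbsMeasure (W : Set Plane) (τ : ℝ≥0) (H : TTessellation W → ℝ) :
    Measure (TTessellation W) :=
  (tessellationMeasure W τ).withDensity fun T => ENNReal.ofReal (Real.exp (-H T))

/-!
Take `k` pairwise nonparallel lines and sweep each of the two half-planes bounded by one of them,
`ℓ₀`, by a front parallel to `ℓ₀`. The front meets a segment from its birth to its death. A segment
that is not present from the start is born on another segment, hence at one of the crossings of its
line with segments already met, and its birth is known from the number of such crossings up to it;
it dies on another segment or on the boundary of `W`, and the deaths are recovered from the number
of segments that each segment kills. The segment of `ℓ₀`, the birth ranks and the numbers of kills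
thus determine the tessellation.

The gain comes from the choice of `ℓ₀`: take a line that meets a maximal number `m` of segments of
other lines. All birth ranks are at most `m`, while the `m` segments that meet `ℓ₀` are present from
the start on both sides and need no birth rank. Hence there are at most
`∑_{m ≤ k} (K (m + 1))^k / (m + 1)^m` tessellations on the `k` lines. This is superexponential in
`k`, but its Poisson average is finite: exchanging the sums bounds it by
`∑_m exp (R (m + 1)) / (m + 1)^m`.
-/

/-! ### Sweeping a half-plane -/

/-- A family of lines seen by a front that moves parallel to itself from time `0` on:
`MeetAt i j t` says that the lines `i` and `j` cross at a point reached at time `t`, and `inner i`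
is the set of the times at which the line `i` is in the interior of the domain. -/
structure SweptLines (ι : Type*) where
  MeetAt : ι → ι → ℝ → Prop
  meetAt_unique : ∀ {i j s t}, MeetAt i j s → MeetAt i j t → s = t
  inner : ι → Set ℝ
  ordConnected_inner : ∀ i, (inner i).OrdConnected

/-- The trace of a T-tessellation in a swept half-plane. The segment of index `i` is crossed by the
front during `[β i, δ i]`; a segment that does not enter the half-plane has `β i = δ i = 0`. -/
structure SweptLines.IsSweep {ι : Type*} (A : SweptLines ι) (β δ : ι → ℝ) : Prop where
  nonneg : ∀ i, 0 ≤ β i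
  lt_or_absent : ∀ i, β i < δ i ∨ (β i = 0 ∧ δ i = 0)
  Ioo_subset : ∀ i, Set.Ioo (β i) (δ i) ⊆ A.inner i
  meet : ∀ {i j t}, 0 < t → A.MeetAt i j t → t ∈ A.inner i →
    t ∈ Set.Icc (β i) (δ i) → t ∈ Set.Icc (β j) (δ j) →
    (t ∈ Set.Ioo (β i) (δ i) ∧ (t = β j ∨ t = δ j)) ∨
    (t ∈ Set.Ioo (β j) (δ j) ∧ (t = β i ∨ t = δ i))
  birth : ∀ i, 0 < β i → β i ∈ A.inner i → ∃ j, A.MeetAt i j (β i) ∧ β i ∈ Set.Ioo (β j) (δ j)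
  death : ∀ i, 0 < δ i → δ i ∈ A.inner i → ∃ j, A.MeetAt i j (δ i) ∧ δ i ∈ Set.Ioo (β j) (δ j)
  host_unique : ∀ {i i' j}, A.MeetAt i j (δ j) → A.MeetAt i' j (δ j) → δ j ∈ A.inner j →
    δ j ∈ Set.Ioo (β i) (δ i) → δ j ∈ Set.Ioo (β i') (δ i') → i = i'

/-- Two families of times agree before `t` when they have the same entries below `t`. -/
def AgreeBefore {κ : Type*} (t : ℝ) (f f' : κ → ℝ) : Prop :=
  ∀ i, f i = f' i ∨ (t ≤ f i ∧ t ≤ f' i)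

namespace AgreeBefore

variable {κ : Type*} {t : ℝ} {f f' : κ → ℝ}

theorem symm (h : AgreeBefore t f f') : AgreeBefore t f' f := fun i => (h i).imp Eq.symm And.symm

theorem eq_of_lt (h : AgreeBefore t f f') {i : κ} (hi : f i < t) : f i = f' i :=
  (h i).resolve_right fun ht => hi.not_ge ht.1

theorem le_iff_le (h : AgreeBefore t f f') {i : κ} {s : ℝ} (hs : s ≤ t) : s ≤ f i ↔ s ≤ f' i := by
  rcases h i with hi | hi
  · rw [hi]
  · exact iff_of_true (hs.trans hi.1) (hs.trans hi.2)

end AgreeBefore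

theorem exists_ne_agreeBefore_min {κ : Type*} [Finite κ] {f f' : κ → ℝ} (h : f ≠ f') :
    ∃ i, f i ≠ f' i ∧ AgreeBefore (min (f i) (f' i)) f f' := by
  obtain ⟨i, hi, hmin⟩ := Set.exists_min_image {i | f i ≠ f' i} (fun i => min (f i) (f' i))
    (Set.toFinite _) (Function.ne_iff.1 h)
  exact ⟨i, hi, fun j => or_iff_not_imp_left.2 fun hj => le_min_iff.1 (hmin j hj)⟩

namespace SweptLines

variable {ι : Type*} {A : SweptLines ι} {β δ β' δ' : ι → ℝ}

namespace IsSweep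

theorem lt_of_pos_birth (h : A.IsSweep β δ) {i : ι} (hi : 0 < β i) : β i < δ i :=
  (h.lt_or_absent i).resolve_right fun h0 => hi.ne' h0.1

theorem lt_of_pos_death (h : A.IsSweep β δ) {i : ι} (hi : 0 < δ i) : β i < δ i :=
  (h.lt_or_absent i).resolve_right fun h0 => hi.ne' h0.2

theorem birth_mem_inner_of_lt (h : A.IsSweep β δ) (h' : A.IsSweep β' δ') {i : ι} (hpos : 0 < β i)
    (hlt : β i < β' i) : β' i ∈ A.inner i := by
  obtain ⟨u, hu, hu'⟩ := exists_between (lt_min (h.lt_of_pos_birth hpos) hlt)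
  obtain ⟨v, hv, hv'⟩ := exists_between (h'.lt_of_pos_birth (hpos.trans hlt))
  obtain ⟨hu_death, hu_birth⟩ := lt_min_iff.1 hu'
  exact (A.ordConnected_inner i).out (h.Ioo_subset i ⟨hu, hu_death⟩) (h'.Ioo_subset i ⟨hv, hv'⟩)
    ⟨hu_birth.le, hv.le⟩

end IsSweep

variable [Fintype ι]

open Classical in
/-- The segments that the line `i` meets between time `0` and the birth of its own segment. Their
number is the birth rank of the segment `i`. -/
noncomputable def metBeforeBirth (A : SweptLines ι) (β δ : ι → ℝ) (i : ι) : Finset ι :=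
  {j | ∃ t ∈ Set.Ioc 0 (β i), A.MeetAt i j t ∧ t ∈ A.inner i ∧ t ∈ Set.Icc (β j) (δ j)}

open Classical in
/-- The segments that die on the segment `i`. -/
noncomputable def kills (A : SweptLines ι) (β δ : ι → ℝ) (i : ι) : Finset ι :=
  {j | A.MeetAt i j (δ j) ∧ δ j ∈ A.inner j ∧ δ j ∈ Set.Ioo (β i) (δ i)}

theorem mem_metBeforeBirth {i j : ι} : j ∈ A.metBeforeBirth β δ i ↔
    ∃ t ∈ Set.Ioc 0 (β i), A.MeetAt i j t ∧ t ∈ A.inner i ∧ t ∈ Set.Icc (β j) (δ j) := by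
  simp [metBeforeBirth]

theorem mem_kills {i j : ι} : j ∈ A.kills β δ i ↔
    A.MeetAt i j (δ j) ∧ δ j ∈ A.inner j ∧ δ j ∈ Set.Ioo (β i) (δ i) := by
  simp [kills]

namespace IsSweep

theorem sum_card_kills_le (h : A.IsSweep β δ) :
    ∑ i, (A.kills β δ i).card ≤ Fintype.card ι := by
  classical
  rw [← Finset.card_biUnion]
  · exact Finset.card_le_univ _
  · intro i _ i' _ hne
    refine Finset.disjoint_left.2 fun j hj hj' => hne ?_
    obtain ⟨hij, hinner, hmem⟩ := mem_kills.1 hj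
    obtain ⟨hij', -, hmem'⟩ := mem_kills.1 hj'
    exact h.host_unique hij hij' hinner hmem hmem'

theorem metBeforeBirth_subset (h : A.IsSweep β δ) {i : ι} (hβ : AgreeBefore (β i) β β')
    (hδ : AgreeBefore (β i) δ δ') (hle : β i ≤ β' i) :
    A.metBeforeBirth β δ i ⊆ A.metBeforeBirth β' δ' i := by
  intro j hj
  obtain ⟨t, ⟨ht0, hti⟩, hmeet, hinner, htj⟩ := mem_metBeforeBirth.1 hj
  have hbirth_lt : β j < β i := by
    rcases hti.lt_or_eq with hlt | rfl
    · exact htj.1.trans_lt hlt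
    · have hpresent : β i ≤ δ i := (h.lt_of_pos_birth ht0).le
      rcases h.meet ht0 hmeet hinner ⟨le_rfl, hpresent⟩ htj with hin | hin
      · exact absurd hin.1.1 (lt_irrefl _)
      · exact hin.1.1
  exact mem_metBeforeBirth.2 ⟨t, ⟨ht0, hti.trans hle⟩, hmeet, hinner,
    hβ.eq_of_lt hbirth_lt ▸ htj.1, (hδ.le_iff_le hti).1 htj.2⟩

/-- A later birth of the segment `i` has to happen on a segment that the line `i` meets after its
first birth, so it increases the birth rank. -/
theorem birth_le_of_card_eq (h : A.IsSweep β δ) (h' : A.IsSweep β' δ') {i : ι} (hpos : 0 < β i)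
    (hβ : AgreeBefore (β i) β β') (hδ : AgreeBefore (β i) δ δ')
    (hcard : (A.metBeforeBirth β δ i).card = (A.metBeforeBirth β' δ' i).card) : β' i ≤ β i := by
  by_contra! hlt
  have hinner := h.birth_mem_inner_of_lt h' hpos hlt
  obtain ⟨j, hmeet, hj⟩ := h'.birth i (hpos.trans hlt) hinner
  have hnew : j ∈ A.metBeforeBirth β' δ' i :=
    mem_metBeforeBirth.2 ⟨β' i, ⟨hpos.trans hlt, le_rfl⟩, hmeet, hinner, hj.1.le, hj.2.le⟩
  rw [← Finset.eq_of_subset_of_card_le (h.metBeforeBirth_subset hβ hδ hlt.le) hcard.ge] at hnew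
  obtain ⟨t, ht, hmeet_t, -⟩ := mem_metBeforeBirth.1 hnew
  exact (A.meetAt_unique hmeet_t hmeet ▸ ht.2).not_gt hlt

/-- When the segment `i` outlives its first death, the segment on which it died first has to die on
it at that time, which increases the number of kills. -/
theorem death_le_of_card_eq (h : A.IsSweep β δ) (h' : A.IsSweep β' δ') {i : ι} (hpos : 0 < δ i)
    (hβ : AgreeBefore (δ i) β β') (hδ : AgreeBefore (δ i) δ δ')
    (hcard : (A.kills β δ i).card = (A.kills β' δ' i).card) : δ' i ≤ δ i := by
  by_contra! hlt
  have hborn := h.lt_of_pos_death hpos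
  have hsame := hβ.eq_of_lt hborn
  have hinside : δ i ∈ Set.Ioo (β' i) (δ' i) := ⟨hsame ▸ hborn, hlt⟩
  have hsubset : A.kills β δ i ⊆ A.kills β' δ' i := fun a ha => by
    obtain ⟨hmeet, hinner, hbirth, hdeath⟩ := mem_kills.1 ha
    rw [hδ.eq_of_lt hdeath] at hmeet hinner hbirth hdeath
    exact mem_kills.2 ⟨hmeet, hinner, hsame ▸ hbirth, hdeath.trans hlt⟩
  obtain ⟨j, hmeet, hj⟩ := h.death i hpos (h'.Ioo_subset i hinside)
  have hj_born : β' j < δ i := hβ.eq_of_lt hj.1 ▸ hj.1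
  have hj_dies : δ i = δ' j := by
    rcases h'.meet hpos hmeet (h'.Ioo_subset i hinside) ⟨hinside.1.le, hinside.2.le⟩
      ⟨hj_born.le, (hδ.le_iff_le le_rfl).1 hj.2.le⟩ with ⟨-, hend⟩ | ⟨-, hend⟩
    · exact hend.resolve_left hj_born.ne'
    · exact (hend.elim hinside.1.ne' hinside.2.ne).elim
  have hnew : j ∈ A.kills β' δ' i :=
    mem_kills.2 ⟨hj_dies ▸ hmeet, hj_dies ▸ h.Ioo_subset j hj, hj_dies ▸ hinside⟩
  rw [← Finset.eq_of_subset_of_card_le hsubset hcard.ge] at hnew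
  exact (mem_kills.1 hnew).2.2.2.not_gt hj.2

theorem not_agreeBefore_of_lt (h : A.IsSweep β δ) (h' : A.IsSweep β' δ')
    (hβ₀ : ∀ i, β i = 0 → β' i = 0) (hδ₀ : ∀ i, δ i = 0 → δ' i = 0)
    (hrank : ∀ i, (A.metBeforeBirth β δ i).card = (A.metBeforeBirth β' δ' i).card)
    (hkills : ∀ i, (A.kills β δ i).card = (A.kills β' δ' i).card) {x : ι ⊕ ι}
    (hlt : Sum.elim β δ x < Sum.elim β' δ' x) :
    ¬ AgreeBefore (Sum.elim β δ x) (Sum.elim β δ) (Sum.elim β' δ') := by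
  intro hagree
  have hβ : AgreeBefore (Sum.elim β δ x) β β' := fun i => hagree (Sum.inl i)
  have hδ : AgreeBefore (Sum.elim β δ x) δ δ' := fun i => hagree (Sum.inr i)
  rcases x with i | i <;> simp only [Sum.elim_inl, Sum.elim_inr] at hlt hβ hδ
  · have hpos : 0 < β i := (h.nonneg i).lt_of_ne' fun h0 =>
      hlt.ne (h0.trans (hβ₀ i h0).symm)
    exact (h.birth_le_of_card_eq h' hpos hβ hδ (hrank i)).not_gt hlt
  · have hnonneg : 0 ≤ δ i := by
      rcases h.lt_or_absent i with hi | hi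
      · exact (h.nonneg i).trans hi.le
      · exact hi.2.ge
    have hpos : 0 < δ i := hnonneg.lt_of_ne' fun h0 => hlt.ne (h0.trans (hδ₀ i h0).symm)
    exact (h.death_le_of_card_eq h' hpos hβ hδ (hkills i)).not_gt hlt

theorem eq_of_card_eq (h : A.IsSweep β δ) (h' : A.IsSweep β' δ')
    (hβ₀ : ∀ i, β i = 0 ↔ β' i = 0) (hδ₀ : ∀ i, δ i = 0 ↔ δ' i = 0)
    (hrank : ∀ i, (A.metBeforeBirth β δ i).card = (A.metBeforeBirth β' δ' i).card)
    (hkills : ∀ i, (A.kills β δ i).card = (A.kills β' δ' i).card) : β = β' ∧ δ = δ' := by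
  suffices heq : Sum.elim β δ = Sum.elim β' δ' from
    ⟨congrArg (· ∘ Sum.inl) heq, congrArg (· ∘ Sum.inr) heq⟩
  by_contra hne
  obtain ⟨x, hx, hagree⟩ := exists_ne_agreeBefore_min hne
  rcases hx.lt_or_gt with hlt | hlt
  · rw [min_eq_left hlt.le] at hagree
    exact h.not_agreeBefore_of_lt h' (fun i => (hβ₀ i).1) (fun i => (hδ₀ i).1) hrank hkills hlt
      hagree
  · rw [min_eq_right hlt.le] at hagree
    exact h'.not_agreeBefore_of_lt h (fun i => (hβ₀ i).2) (fun i => (hδ₀ i).2)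
      (fun i => (hrank i).symm) (fun i => (hkills i).symm) hlt hagree.symm

end IsSweep

end SweptLines

/-! ### Points, lines and segments in coordinates -/

/-- The coordinate of `x` along the unit vector `(cos α, sin α)` normal to a line `(α, p)`. -/
noncomputable def normalCoord (l : LineParam) (x : Plane) : ℝ :=
  x 0 * Real.cos l.1 + x 1 * Real.sin l.1

/-- The coordinate of `x` along the unit vector `(-sin α, cos α)` directing a line `(α, p)`. -/
noncomputable def tangentCoord (l : LineParam) (x : Plane) : ℝ :=
  x 1 * Real.cos l.1 - x 0 * Real.sin l.1

/-- Incidence of a point and a line. -/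
def OnLine (l : LineParam) (x : Plane) : Prop := normalCoord l x = l.2

theorem normalCoord_linePoint (l m : LineParam) (t : ℝ) :
    normalCoord m (linePoint l t) =
      l.2 * Real.cos (l.1 - m.1) - t * Real.sin (l.1 - m.1) := by
  simp only [normalCoord, linePoint, PiLp.toLp_apply, Matrix.cons_val_zero, Matrix.cons_val_one,
    Matrix.cons_val_fin_one, Real.cos_sub, Real.sin_sub]
  ring

theorem onLine_linePoint (l : LineParam) (t : ℝ) : OnLine l (linePoint l t) := by
  simp [OnLine, normalCoord_linePoint]

theorem tangentCoord_linePoint (l : LineParam) (t : ℝ) : tangentCoord l (linePoint l t) = t := by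
  simp only [tangentCoord, linePoint, PiLp.toLp_apply, Matrix.cons_val_zero, Matrix.cons_val_one,
    Matrix.cons_val_fin_one]
  linear_combination t * Real.sin_sq_add_cos_sq l.1

theorem OnLine.linePoint_tangentCoord {l : LineParam} {x : Plane} (h : OnLine l x) :
    linePoint l (tangentCoord l x) = x := by
  have hsq := Real.sin_sq_add_cos_sq l.1
  rw [OnLine, normalCoord] at h
  ext i
  fin_cases i
  · simp only [linePoint, ← h, tangentCoord, Fin.zero_eta, Matrix.cons_val_zero]
    linear_combination x 0 * hsq
  · simp only [linePoint, ← h, tangentCoord, Fin.mk_one, Matrix.cons_val_one,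
      Matrix.cons_val_fin_one]
    linear_combination x 1 * hsq

theorem linePoint_eq_iff {l : LineParam} {t : ℝ} {x : Plane} :
    linePoint l t = x ↔ OnLine l x ∧ tangentCoord l x = t := by
  constructor
  · rintro rfl
    exact ⟨onLine_linePoint l t, tangentCoord_linePoint l t⟩
  · rintro ⟨h, rfl⟩
    exact h.linePoint_tangentCoord

theorem mem_image_linePoint {l : LineParam} {A : Set ℝ} {x : Plane} :
    x ∈ linePoint l '' A ↔ OnLine l x ∧ tangentCoord l x ∈ A := by
  simp only [Set.mem_image, linePoint_eq_iff]
  exact ⟨fun ⟨_, ht, h, hx⟩ => ⟨h, hx ▸ ht⟩, fun ⟨h, ht⟩ => ⟨_, ht, h, rfl⟩⟩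

namespace SegParam

variable {s : SegParam} {x : Plane}

theorem mem_carrier :
    x ∈ s.carrier ↔ OnLine s.1 x ∧ tangentCoord s.1 x ∈ Set.Icc s.2.1 s.2.2 :=
  mem_image_linePoint

theorem mem_inside : x ∈ s.inside ↔ OnLine s.1 x ∧ tangentCoord s.1 x ∈ Set.Ioo s.2.1 s.2.2 :=
  mem_image_linePoint

theorem mem_ends :
    x ∈ s.ends ↔ OnLine s.1 x ∧ (tangentCoord s.1 x = s.2.1 ∨ tangentCoord s.1 x = s.2.2) := by
  simp only [ends, Set.mem_insert_iff, Set.mem_singleton_iff, eq_comm (a := x), linePoint_eq_iff]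
  tauto

theorem notMem_ends_of_mem_inside (h : x ∈ s.inside) : x ∉ s.ends := fun hend => by
  rw [mem_inside] at h
  rcases (mem_ends.1 hend).2 with hx | hx
  · exact h.2.1.ne' hx
  · exact h.2.2.ne hx

end SegParam

theorem linePoint_eq_lineMap (l : LineParam) :
    linePoint l = AffineMap.lineMap (k := ℝ) (linePoint l 0) (linePoint l 1) := by
  ext t i
  fin_cases i <;> simp [linePoint, AffineMap.lineMap_apply] <;> ring

theorem convex_linePoint_preimage (l : LineParam) {V : Set Plane} (hV : Convex ℝ V) :
    Convex ℝ (linePoint l ⁻¹' V) :=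
  linePoint_eq_lineMap l ▸ hV.affine_preimage _

theorem continuous_linePoint_uncurry : Continuous fun q : LineParam × ℝ => linePoint q.1 q.2 := by
  unfold linePoint
  refine (PiLp.continuous_toLp 2 _).comp (continuous_pi fun i => ?_)
  fin_cases i <;> simp only [Fin.zero_eta, Fin.mk_one, Matrix.cons_val_zero, Matrix.cons_val_one,
    Matrix.cons_val_fin_one] <;> fun_prop

/-- The directions of two lines differ. The angles need not be normalised, hence the sine. -/
def Nonparallel (l m : LineParam) : Prop := Real.sin (l.1 - m.1) ≠ 0

/-- The abscissa on the line `l` of its crossing with a nonparallel line `m`. -/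
noncomputable def crossAbscissa (l m : LineParam) : ℝ :=
  (l.2 * Real.cos (l.1 - m.1) - m.2) / Real.sin (l.1 - m.1)

theorem nonparallel_of_onLine {l m : LineParam} (hl : l.1 ∈ Set.Ico 0 Real.pi)
    (hm : m.1 ∈ Set.Ico 0 Real.pi) (hne : l ≠ m) {x : Plane} (hxl : OnLine l x)
    (hxm : OnLine m x) : Nonparallel l m := by
  rw [Nonparallel, Ne, Real.sin_eq_zero_iff_of_lt_of_lt (by linarith [hl.1, hm.2])
    (by linarith [hl.2, hm.1]), sub_eq_zero]
  intro hangle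
  refine hne (Prod.ext hangle ?_)
  rw [← hxl, ← hxm, normalCoord, normalCoord, hangle]

namespace Nonparallel

variable {l m : LineParam}

theorem ne (h : Nonparallel l m) : l ≠ m := by
  rintro rfl
  simp [Nonparallel] at h

theorem tangentCoord_eq_crossAbscissa (h : Nonparallel l m) {x : Plane} (hxl : OnLine l x)
    (hxm : OnLine m x) : tangentCoord l x = crossAbscissa l m := by
  have hx := normalCoord_linePoint l m (tangentCoord l x)
  rw [hxl.linePoint_tangentCoord, hxm] at hx
  rw [crossAbscissa, eq_div_iff h]
  linarith

theorem eq_of_onLine (h : Nonparallel l m) {x y : Plane} (hxl : OnLine l x) (hxm : OnLine m x)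
    (hyl : OnLine l y) (hym : OnLine m y) : x = y := by
  rw [← hxl.linePoint_tangentCoord, ← hyl.linePoint_tangentCoord,
    h.tangentCoord_eq_crossAbscissa hxl hxm, h.tangentCoord_eq_crossAbscissa hyl hym]

end Nonparallel

/-! ### Tessellations as tuples of segments -/

theorem SegParam.mem_inside_or_mem_ends {a : SegParam} {x : Plane} (h : x ∈ a.carrier) :
    x ∈ a.inside ∨ x ∈ a.ends := by
  obtain ⟨hline, hb, hd⟩ := SegParam.mem_carrier.1 h
  rw [SegParam.mem_inside, SegParam.mem_ends]
  rcases hb.eq_or_lt with hb | hb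
  · exact Or.inr ⟨hline, Or.inl hb.symm⟩
  · rcases hd.eq_or_lt with hd | hd
    · exact Or.inr ⟨hline, Or.inr hd⟩
    · exact Or.inl ⟨hline, hb, hd⟩

namespace TTessellation

variable {W : Set Plane} {T : TTessellation W} {a b c : SegParam} {x : Plane}

theorem mem_points_lines {l : LineParam} :
    l ∈ T.lines.points ↔ ∃ a ∈ T.segments, a.1 = l := by
  classical
  simp [lines]

theorem nonparallel_of_onLine (ha : a ∈ T.segments) (hb : b ∈ T.segments) (hab : a ≠ b)
    (hxa : OnLine a.1 x) (hxb : OnLine b.1 x) : Nonparallel a.1 b.1 :=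
  _root_.nonparallel_of_onLine (T.angle_mem a ha) (T.angle_mem b hb)
    (fun h => hab (T.not_aligned a ha b hb h)) hxa hxb

theorem exists_mem_inside_of_mem_ends (ha : a ∈ T.segments) (hxa : x ∈ a.ends)
    (hxW : x ∈ interior W) : ∃ b ∈ T.segments, a ≠ b ∧ x ∈ b.inside := by
  obtain ⟨b, ⟨hb, hxb⟩, -⟩ := (T.tShaped x hxW (Or.inl ⟨a, ha, hxa⟩)).1
  exact ⟨b, hb, fun hab => SegParam.notMem_ends_of_mem_inside hxb (hab ▸ hxa), hxb⟩

theorem eq_of_mem_inside_of_mem_ends (ha : a ∈ T.segments) (hb : b ∈ T.segments)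
    (hc : c ∈ T.segments) (hxW : x ∈ interior W) (hxc : x ∈ c.ends) (hxa : x ∈ a.inside)
    (hxb : x ∈ b.inside) : a = b :=
  (T.tShaped x hxW (Or.inl ⟨c, hc, hxc⟩)).1.unique ⟨ha, hxa⟩ ⟨hb, hxb⟩

theorem mem_inside_and_mem_ends_of_mem_carrier (ha : a ∈ T.segments) (hb : b ∈ T.segments)
    (hab : a ≠ b) (hxW : x ∈ interior W) (hxa : x ∈ a.carrier) (hxb : x ∈ b.carrier) :
    (x ∈ a.inside ∧ x ∈ b.ends) ∨ (x ∈ b.inside ∧ x ∈ a.ends) := by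
  obtain ⟨hinside, hends⟩ := T.tShaped x hxW (Or.inr ⟨a, ha, b, hb, hab, hxa, hxb⟩)
  rcases SegParam.mem_inside_or_mem_ends hxa with ha' | ha' <;>
    rcases SegParam.mem_inside_or_mem_ends hxb with hb' | hb'
  · exact absurd (hinside.unique ⟨ha, ha'⟩ ⟨hb, hb'⟩) hab
  · exact Or.inl ⟨ha', hb'⟩
  · exact Or.inr ⟨hb', ha'⟩
  · exact absurd (hends.unique ⟨ha, ha'⟩ ⟨hb, hb'⟩) hab

end TTessellation

theorem FinConfig.mem_points_ofTuple {α : Type*} {k : ℕ} {s : Fin k → α} {a : α} :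
    a ∈ (FinConfig.ofTuple s).points ↔ ∃ i, s i = a := by
  simp [FinConfig.ofTuple]

theorem FinConfig.apply_mem_points_ofTuple {α : Type*} {k : ℕ} (s : Fin k → α) (i : Fin k) :
    s i ∈ (FinConfig.ofTuple s).points :=
  FinConfig.mem_points_ofTuple.2 ⟨i, rfl⟩

/-- The tuples of segments, supported in the same order by the lines of the tuple `l`, whose values
are the segments of a T-tessellation. -/
def tessTuples (W : Set Plane) {k : ℕ} (l : Fin k → LineParam) : Set (Fin k → SegParam) :=
  {s | (∃ T : TTessellation W, T.segments = (FinConfig.ofTuple s).points) ∧ ∀ i, (s i).1 = l i}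

section TessTuples

variable {W : Set Plane} {k : ℕ} {l : Fin k → LineParam}

theorem exists_mem_segments_iff_of_mem_tessTuples {s : Fin k → SegParam} (hs : s ∈ tessTuples W l) :
    ∃ T : TTessellation W, ∀ a, a ∈ T.segments ↔ ∃ i, s i = a := by
  obtain ⟨⟨T, hT⟩, -⟩ := hs
  exact ⟨T, fun a => by rw [hT, FinConfig.mem_points_ofTuple]⟩

theorem TTessellation.lines_eq_ofTuple {T : TTessellation W} {s : Fin k → SegParam}
    (hT : T.segments = (FinConfig.ofTuple s).points) (hs : ∀ i, (s i).1 = l i) :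
    T.lines = FinConfig.ofTuple l := by
  ext x
  rw [TTessellation.mem_points_lines, FinConfig.mem_points_ofTuple, hT]
  simp only [FinConfig.mem_points_ofTuple, exists_exists_eq_and, hs]

theorem TTessellation.exists_tuple_of_lines_eq {T : TTessellation W}
    (hT : T.lines = FinConfig.ofTuple l) :
    ∃ s ∈ tessTuples W l, T.segments = (FinConfig.ofTuple s).points := by
  have hsegment : ∀ i, ∃ a ∈ T.segments, a.1 = l i := fun i => by
    rw [← TTessellation.mem_points_lines, hT]
    exact FinConfig.apply_mem_points_ofTuple l i
  choose s hsT hsl using hsegment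
  suffices hpoints : T.segments = (FinConfig.ofTuple s).points from
    ⟨s, ⟨⟨T, hpoints⟩, hsl⟩, hpoints⟩
  ext a
  rw [FinConfig.mem_points_ofTuple]
  constructor
  · intro ha
    have hline : a.1 ∈ T.lines.points := TTessellation.mem_points_lines.2 ⟨a, ha, rfl⟩
    rw [hT] at hline
    obtain ⟨i, hi⟩ := FinConfig.mem_points_ofTuple.1 hline
    exact ⟨i, T.not_aligned _ (hsT i) _ ha ((hsl i).trans hi)⟩
  · rintro ⟨i, rfl⟩
    exact hsT i

theorem eq_of_mem_tessTuples_of_points_eq {s s' : Fin k → SegParam} (hs : s ∈ tessTuples W l)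
    (hs' : s' ∈ tessTuples W l) (h : (FinConfig.ofTuple s).points = (FinConfig.ofTuple s').points) :
    s = s' := by
  obtain ⟨⟨T, hT⟩, hsl⟩ := hs
  funext i
  refine T.not_aligned _ ?_ _ ?_ ((hsl i).trans (hs'.2 i).symm)
  · exact hT ▸ FinConfig.apply_mem_points_ofTuple s i
  · exact hT ▸ h ▸ FinConfig.apply_mem_points_ofTuple s' i

/-- The correspondence between the tuples of `tessTuples W l` and the T-tessellations that they
describe. -/
noncomputable def tessTuplesEquiv (W : Set Plane) {k : ℕ} (l : Fin k → LineParam) :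
    tessTuples W l ≃ {T : TTessellation W // T.lines = FinConfig.ofTuple l} :=
  Equiv.ofBijective
    (fun s => ⟨s.2.1.choose, TTessellation.lines_eq_ofTuple s.2.1.choose_spec s.2.2⟩) <| by
    constructor
    · intro s s' h
      have hsegments : s.2.1.choose.segments = s'.2.1.choose.segments :=
        congrArg (fun T => T.1.segments) h
      rw [s.2.1.choose_spec, s'.2.1.choose_spec] at hsegments
      exact Subtype.ext (eq_of_mem_tessTuples_of_points_eq s.2 s'.2 hsegments)
    · rintro ⟨T, hT⟩
      obtain ⟨s, hs, hTs⟩ := TTessellation.exists_tuple_of_lines_eq hT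
      exact ⟨⟨s, hs⟩, Subtype.ext (TTessellation.ext (hs.1.choose_spec.trans hTs.symm))⟩

theorem segments_tessTuplesEquiv (s : tessTuples W l) :
    (tessTuplesEquiv W l s).1.segments = (FinConfig.ofTuple s.1).points :=
  s.2.1.choose_spec

end TessTuples

/-! ### The possible endpoints of segments -/

/-- The abscissa at which a line enters the interior of `W`. The infimum is taken in `EReal` so that
it depends measurably on the line even when it is not attained by a real number. -/
noncomputable def entryAbscissa (W : Set Plane) (l : LineParam) : ℝ :=
  (sInf (Real.toEReal '' (linePoint l ⁻¹' interior W))).toReal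

/-- The same line with the opposite orientation. -/
noncomputable def reversedLine (l : LineParam) : LineParam := (l.1 + Real.pi, -l.2)

/-- The abscissa at which a line leaves the interior of `W`. -/
noncomputable def exitAbscissa (W : Set Plane) (l : LineParam) : ℝ :=
  -entryAbscissa W (reversedLine l)

theorem linePoint_reversedLine (l : LineParam) (t : ℝ) :
    linePoint (reversedLine l) t = linePoint l (-t) := by
  ext i
  fin_cases i <;> simp [linePoint, reversedLine]

section Endpoints

variable {W : Set Plane}

theorem entryAbscissa_eq (hW : Convex ℝ W) {l : LineParam} {b d : ℝ} (hbd : b < d)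
    (hsub : ∀ t ∈ Set.Ioo b d, linePoint l t ∈ interior W) (hb : linePoint l b ∉ interior W) :
    entryAbscissa W l = b := by
  have hconn := (convex_linePoint_preimage l hW.interior).ordConnected
  have hGLB : IsGLB (linePoint l ⁻¹' interior W) b := by
    refine ⟨fun t ht => not_lt.1 fun htb => hb ?_,
      fun c hc => (isGLB_Ioo hbd).2 fun t ht => hc (hsub t ht)⟩
    obtain ⟨u, hu⟩ := exists_between hbd
    exact hconn.out ht (hsub u hu) ⟨htb.le, hu.1.le⟩
  obtain ⟨u, hu⟩ := exists_between hbd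
  have hne : (linePoint l ⁻¹' interior W).Nonempty := ⟨u, hsub u hu⟩
  rw [entryAbscissa, ← Monotone.map_csInf_of_continuousAt continuous_coe_real_ereal.continuousAt
    EReal.coe_strictMono.monotone hne hGLB.bddBelow, hGLB.csInf_eq hne, EReal.toReal_coe]

theorem exitAbscissa_eq (hW : Convex ℝ W) {l : LineParam} {b d : ℝ} (hbd : b < d)
    (hsub : ∀ t ∈ Set.Ioo b d, linePoint l t ∈ interior W) (hd : linePoint l d ∉ interior W) :
    exitAbscissa W l = d := by
  have hsub' : ∀ t ∈ Set.Ioo (-d) (-b), linePoint (reversedLine l) t ∈ interior W := fun t ht => by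
    rw [linePoint_reversedLine]
    exact hsub _ ⟨lt_neg_of_lt_neg ht.2, neg_lt_of_neg_lt ht.1⟩
  have hd' : linePoint (reversedLine l) (-d) ∉ interior W := by
    rwa [linePoint_reversedLine, neg_neg]
  rw [exitAbscissa, entryAbscissa_eq hW (neg_lt_neg hbd) hsub' hd', neg_neg]

variable {k : ℕ}

/-- A segment on the line `l i` is coded by the lines on which it begins and ends; `none` stands for
the boundary of `W`. -/
noncomputable def codedSegment (W : Set Plane) (l : Fin k → LineParam) (i : Fin k)
    (c : Option (Fin k) × Option (Fin k)) : SegParam :=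
  (l i, c.1.elim (entryAbscissa W (l i)) fun j => crossAbscissa (l i) (l j),
    c.2.elim (exitAbscissa W (l i)) fun j => crossAbscissa (l i) (l j))

variable {l : Fin k → LineParam} {s : Fin k → SegParam}

theorem exists_eq_crossAbscissa_of_mem_ends (hs : s ∈ tessTuples W l) {i : Fin k} {t : ℝ}
    (hends : linePoint (l i) t ∈ (s i).ends) (hW : linePoint (l i) t ∈ interior W) :
    ∃ j, crossAbscissa (l i) (l j) = t := by
  obtain ⟨T, hT⟩ := exists_mem_segments_iff_of_mem_tessTuples hs
  have hi := (hT _).2 ⟨i, rfl⟩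
  obtain ⟨b, hb, hne, hinside⟩ := T.exists_mem_inside_of_mem_ends hi hends hW
  obtain ⟨j, rfl⟩ := (hT b).1 hb
  have honi := (SegParam.mem_ends.1 hends).1
  have honj := (SegParam.mem_inside.1 hinside).1
  have hcross :=
    (T.nonparallel_of_onLine hi hb hne honi honj).tangentCoord_eq_crossAbscissa honi honj
  rw [hs.2, hs.2, tangentCoord_linePoint] at hcross
  exact ⟨j, hcross.symm⟩

theorem exists_codedSegment_eq (hW : Convex ℝ W) (hs : s ∈ tessTuples W l) (i : Fin k) :
    ∃ c, codedSegment W l i c = s i := by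
  obtain ⟨T, hT⟩ := exists_mem_segments_iff_of_mem_tessTuples hs
  have hi := (hT _).2 ⟨i, rfl⟩
  have hlt := T.birth_lt_death _ hi
  have hsub : ∀ t ∈ Set.Ioo (s i).2.1 (s i).2.2, linePoint (l i) t ∈ interior W := fun t ht =>
    T.inside_subset _ hi ⟨t, ht, by rw [hs.2]⟩
  have hbegin : ∃ c : Option (Fin k),
      c.elim (entryAbscissa W (l i)) (fun j => crossAbscissa (l i) (l j)) = (s i).2.1 := by
    by_cases hin : linePoint (l i) (s i).2.1 ∈ interior W
    · obtain ⟨j, hj⟩ := exists_eq_crossAbscissa_of_mem_ends hs (Or.inl (by rw [hs.2])) hin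
      exact ⟨some j, hj⟩
    · exact ⟨none, entryAbscissa_eq hW hlt hsub hin⟩
  have hend : ∃ c : Option (Fin k),
      c.elim (exitAbscissa W (l i)) (fun j => crossAbscissa (l i) (l j)) = (s i).2.2 := by
    by_cases hin : linePoint (l i) (s i).2.2 ∈ interior W
    · obtain ⟨j, hj⟩ := exists_eq_crossAbscissa_of_mem_ends hs
        (Or.inr (Set.mem_singleton_iff.2 (by rw [hs.2]))) hin
      exact ⟨some j, hj⟩
    · exact ⟨none, exitAbscissa_eq hW hlt hsub hin⟩
  obtain ⟨c, hc⟩ := hbegin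
  obtain ⟨d, hd⟩ := hend
  exact ⟨(c, d), Prod.ext (hs.2 i).symm (Prod.ext hc hd)⟩

theorem finite_tessTuples (hW : Convex ℝ W) (l : Fin k → LineParam) : (tessTuples W l).Finite := by
  refine (Set.finite_range fun c : Fin k → Option (Fin k) × Option (Fin k) =>
    fun i => codedSegment W l i (c i)).subset fun s hs => ?_
  choose c hc using exists_codedSegment_eq hW hs
  exact ⟨c, funext hc⟩

end Endpoints

/-! ### Measurability of the number of tessellations -/

section EnumeratedSums

variable {α β κ : Type*} [MeasurableSpace α] [MeasurableSpace β] [MeasurableEq β]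

/-- Each point of `S a` is counted at the least index that produces it. -/
theorem measurable_tsum_of_subset_range [Countable κ] {g : κ → α → β} (hg : ∀ c, Measurable (g c))
    {S : α → Set β} (hS : Measurable fun p : α × β => p.2 ∈ S p.1)
    (hrange : ∀ a, S a ⊆ Set.range fun c => g c a) {F : β → ℝ≥0∞} (hF : Measurable F) :
    Measurable fun a => ∑' b : S a, F b := by
  classical
  obtain ⟨_, _⟩ := exists_wellFoundedLT κ
  let least : α → Set κ := fun a => {c | g c a ∈ S a ∧ ∀ c' < c, g c' a ≠ g c a}
  have hinj : ∀ a, Set.InjOn (fun c => g c a) (least a) := fun a c hc d hd hcd => by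
    rcases lt_trichotomy c d with h | h | h
    · exact absurd hcd (hd.2 c h)
    · exact h
    · exact absurd hcd.symm (hc.2 d h)
  have himage : ∀ a, (fun c => g c a) '' least a = S a := fun a => by
    refine Set.Subset.antisymm (Set.image_subset_iff.2 fun c hc => hc.1) fun b hb => ?_
    obtain ⟨c, hc, hmin⟩ := wellFounded_lt.has_min {c | g c a = b} (hrange a hb)
    exact ⟨c, ⟨hc.symm ▸ hb, fun d hd h => hmin d (h.trans hc) hd⟩, hc⟩
  have hsum : ∀ a, ∑' b : S a, F b = ∑' c, if c ∈ least a then F (g c a) else 0 := fun a => by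
    rw [tsum_congr_set_coe F (himage a).symm, tsum_image F (hinj a),
      tsum_subtype (least a) fun c => F (g c a)]
    exact tsum_congr fun c => Set.indicator_apply _ _ _
  simp only [hsum]
  refine .tsum fun c => .ite (measurableSet_setOfPred.2 (.and ?_ ?_)) (hF.comp (hg c))
    measurable_const
  · exact hS.comp (measurable_id.prodMk (hg c))
  · exact .forall fun c' => .imp measurable_const
      (measurableSet_setOfPred.1 (measurableSet_eq_fun (hg c') (hg c))).not

end EnumeratedSums

theorem FinConfig.measurable_of_comp_ofTuple {α β : Type*} [MeasurableSpace α] [MeasurableSpace β]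
    {f : FinConfig α → β} (h : ∀ k, Measurable fun x : Fin k → α => f (FinConfig.ofTuple x)) :
    Measurable f := fun _ hS => MeasurableSpace.measurableSet_iInf.2 fun k => h k hS

theorem measurable_entryAbscissa (W : Set Plane) : Measurable (entryAbscissa W) := by
  refine measurable_ereal_toReal.comp (measurable_of_Iio fun r => IsOpen.measurableSet ?_)
  have hunion : (fun l => sInf (Real.toEReal '' (linePoint l ⁻¹' interior W))) ⁻¹' Set.Iio r =
      ⋃ t : ℝ, ⋃ _ : (t : EReal) < r, {l | linePoint l t ∈ interior W} := by
    ext l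
    simp only [Set.mem_preimage, Set.mem_Iio, sInf_lt_iff, Set.exists_mem_image, Set.mem_iUnion,
      Set.mem_ofPred_eq, exists_prop]
    exact exists_congr fun t => and_comm
  rw [hunion]
  exact isOpen_iUnion fun t => isOpen_iUnion fun _ => isOpen_interior.preimage
    (continuous_linePoint_uncurry.comp (Continuous.prodMk_left t))

theorem measurable_exitAbscissa (W : Set Plane) : Measurable (exitAbscissa W) :=
  ((measurable_entryAbscissa W).comp
    (by unfold reversedLine; fun_prop : Measurable reversedLine)).neg

section MeasurablePredicates

variable {α : Type*} [MeasurableSpace α] {f : α → SegParam} {g h : α → LineParam} {x : α → Plane}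

theorem measurable_eq_fun {β : Type*} [MeasurableSpace β] [MeasurableEq β] {u v : α → β}
    (hu : Measurable u) (hv : Measurable v) : Measurable fun a => u a = v a :=
  measurableSet_setOfPred.1 (measurableSet_eq_fun hu hv)

theorem measurable_crossAbscissa (hg : Measurable g) (hh : Measurable h) :
    Measurable fun a => crossAbscissa (g a) (h a) := by
  unfold crossAbscissa
  fun_prop

theorem measurable_linePoint {t : α → ℝ} (hg : Measurable g) (ht : Measurable t) :
    Measurable fun a => linePoint (g a) (t a) :=
  continuous_linePoint_uncurry.measurable.comp (hg.prodMk ht)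

theorem measurable_plane_apply (hx : Measurable x) (i : Fin 2) : Measurable fun a => x a i :=
  (EuclideanSpace.proj (ι := Fin 2) (𝕜 := ℝ) i).continuous.measurable.comp hx

theorem measurable_tangentCoord (hg : Measurable g) (hx : Measurable x) :
    Measurable fun a => tangentCoord (g a) (x a) := by
  have := measurable_plane_apply hx
  unfold tangentCoord
  fun_prop

theorem measurable_onLine (hg : Measurable g) (hx : Measurable x) :
    Measurable fun a => OnLine (g a) (x a) := by
  have := measurable_plane_apply hx
  unfold OnLine normalCoord
  exact measurable_eq_fun (by fun_prop) hg.snd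

theorem measurable_mem_carrier (hf : Measurable f) (hx : Measurable x) :
    Measurable fun a => x a ∈ (f a).carrier := by
  have htangent := measurable_tangentCoord hf.fst hx
  simp only [SegParam.mem_carrier]
  exact (measurable_onLine hf.fst hx).and
    ((measurableSet_setOfPred.1 (measurableSet_le hf.snd.fst htangent)).and
      (measurableSet_setOfPred.1 (measurableSet_le htangent hf.snd.snd)))

theorem measurable_mem_inside (hf : Measurable f) (hx : Measurable x) :
    Measurable fun a => x a ∈ (f a).inside := by
  have htangent := measurable_tangentCoord hf.fst hx
  simp only [SegParam.mem_inside]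
  exact (measurable_onLine hf.fst hx).and
    ((measurableSet_setOfPred.1 (measurableSet_lt hf.snd.fst htangent)).and
      (measurableSet_setOfPred.1 (measurableSet_lt htangent hf.snd.snd)))

theorem measurable_mem_ends (hf : Measurable f) (hx : Measurable x) :
    Measurable fun a => x a ∈ (f a).ends := by
  have htangent := measurable_tangentCoord hf.fst hx
  simp only [SegParam.mem_ends]
  exact (measurable_onLine hf.fst hx).and
    ((measurable_eq_fun htangent hf.snd.fst).or (measurable_eq_fun htangent hf.snd.snd))

theorem measurable_inside_subset_interior {W : Set Plane} (hW : Convex ℝ W) :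
    Measurable fun a : SegParam => a.inside ⊆ interior W := by
  have hrat : ∀ a : SegParam, a.inside ⊆ interior W ↔ ∀ q : ℚ,
      a.2.1 < (q : ℝ) → (q : ℝ) < a.2.2 → linePoint a.1 q ∈ interior W := fun a => by
    refine ⟨fun h q hbq hqd => h ⟨q, ⟨hbq, hqd⟩, rfl⟩, ?_⟩
    rintro h _ ⟨t, ⟨hbt, htd⟩, rfl⟩
    obtain ⟨q, hbq, hqt⟩ := exists_rat_btwn hbt
    obtain ⟨r, htr, hrd⟩ := exists_rat_btwn htd
    exact (convex_linePoint_preimage a.1 hW.interior).ordConnected.out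
      (h q hbq (hqt.trans htd)) (h r (hbt.trans htr) hrd) ⟨hqt.le, htr.le⟩
  simp only [hrat]
  refine .forall fun q => .imp ?_ (.imp ?_ ?_)
  · exact measurableSet_setOfPred.1 (measurableSet_lt (by fun_prop) (by fun_prop))
  · exact measurableSet_setOfPred.1 (measurableSet_lt (by fun_prop) (by fun_prop))
  · exact measurableSet_setOfPred.1
      (measurable_linePoint measurable_fst measurable_const isOpen_interior.measurableSet)

end MeasurablePredicates

section TupleVertices

variable {k : ℕ}

theorem existsUnique_mem_points_ofTuple {s : Fin k → SegParam} {P : SegParam → Prop} :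
    (∃! a, a ∈ (FinConfig.ofTuple s).points ∧ P a) ↔ ∃ i, P (s i) ∧ ∀ j, P (s j) → s j = s i := by
  simp only [ExistsUnique, FinConfig.mem_points_ofTuple]
  constructor
  · rintro ⟨_, ⟨⟨i, rfl⟩, hi⟩, hunique⟩
    exact ⟨i, hi, fun j hj => hunique _ ⟨⟨j, rfl⟩, hj⟩⟩
  · rintro ⟨i, hi, hunique⟩
    refine ⟨s i, ⟨⟨i, rfl⟩, hi⟩, ?_⟩
    rintro _ ⟨⟨j, rfl⟩, hj⟩
    exact hunique j hj

theorem isVertex_ofTuple_iff {s : Fin k → SegParam} {x : Plane} :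
    IsVertex (FinConfig.ofTuple s).points x ↔ (∃ i, x ∈ (s i).ends) ∨
      ∃ i j, s i ≠ s j ∧ x ∈ (s i).carrier ∧ x ∈ (s j).carrier := by
  simp [IsVertex, FinConfig.mem_points_ofTuple]

variable {x : (Fin k → SegParam) → Plane}

theorem measurable_isVertex (hx : Measurable x) :
    Measurable fun s : Fin k → SegParam => IsVertex (FinConfig.ofTuple s).points (x s) := by
  have hp : ∀ i : Fin k, Measurable fun s : Fin k → SegParam => s i := measurable_pi_apply
  simp only [isVertex_ofTuple_iff]
  exact (Measurable.exists fun i => measurable_mem_ends (hp i) hx).or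
    (.exists fun i => .exists fun j => (measurable_eq_fun (hp i) (hp j)).not.and
      ((measurable_mem_carrier (hp i) hx).and (measurable_mem_carrier (hp j) hx)))

theorem measurable_isTShaped (hx : Measurable x) :
    Measurable fun s : Fin k → SegParam => IsTShaped (FinConfig.ofTuple s).points (x s) := by
  have hp : ∀ i : Fin k, Measurable fun s : Fin k → SegParam => s i := measurable_pi_apply
  simp only [IsTShaped, existsUnique_mem_points_ofTuple]
  exact .and
    (.exists fun i => (measurable_mem_inside (hp i) hx).and (.forall fun j =>
      (measurable_mem_inside (hp j) hx).imp (measurable_eq_fun (hp j) (hp i))))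
    (.exists fun i => (measurable_mem_ends (hp i) hx).and (.forall fun j =>
      (measurable_mem_ends (hp j) hx).imp (measurable_eq_fun (hp j) (hp i))))

/-- The finitely many points at which the T-shape of the vertices has to be tested: the beginnings
of the segments, their ends, and the crossings of their lines. -/
noncomputable def candidateVertex (s : Fin k → SegParam) :
    Fin k ⊕ Fin k ⊕ Fin k × Fin k → Plane
  | .inl i => linePoint (s i).1 (s i).2.1
  | .inr (.inl i) => linePoint (s i).1 (s i).2.2
  | .inr (.inr (i, j)) => linePoint (s i).1 (crossAbscissa (s i).1 (s j).1)

theorem measurable_candidateVertex (c : Fin k ⊕ Fin k ⊕ Fin k × Fin k) :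
    Measurable fun s : Fin k → SegParam => candidateVertex s c := by
  have hp : ∀ i : Fin k, Measurable fun s : Fin k → SegParam => s i := measurable_pi_apply
  rcases c with i | i | ⟨i, j⟩
  · exact measurable_linePoint (hp i).fst (hp i).snd.fst
  · exact measurable_linePoint (hp i).fst (hp i).snd.snd
  · exact measurable_linePoint (hp i).fst (measurable_crossAbscissa (hp i).fst (hp j).fst)

theorem exists_candidateVertex_eq {s : Fin k → SegParam}
    (hangle : ∀ i, (s i).1.1 ∈ Set.Ico 0 Real.pi) (hline : ∀ i j, (s i).1 = (s j).1 → s i = s j)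
    {x : Plane} (hx : IsVertex (FinConfig.ofTuple s).points x) : ∃ c, candidateVertex s c = x := by
  rcases isVertex_ofTuple_iff.1 hx with ⟨i, rfl | rfl⟩ | ⟨i, j, hij, hi, hj⟩
  · exact ⟨.inl i, rfl⟩
  · exact ⟨.inr (.inl i), rfl⟩
  · have honi := (SegParam.mem_carrier.1 hi).1
    have honj := (SegParam.mem_carrier.1 hj).1
    have hcross :=
      nonparallel_of_onLine (hangle i) (hangle j) (fun h => hij (hline i j h)) honi honj
    refine ⟨.inr (.inr (i, j)), ?_⟩
    rw [candidateVertex, ← hcross.tangentCoord_eq_crossAbscissa honi honj,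
      honi.linePoint_tangentCoord]

theorem exists_segments_eq_ofTuple_iff {W : Set Plane} {s : Fin k → SegParam} :
    (∃ T : TTessellation W, T.segments = (FinConfig.ofTuple s).points) ↔
      (∀ i, (s i).1.1 ∈ Set.Ico 0 Real.pi) ∧ (∀ i, (s i).2.1 < (s i).2.2) ∧
      (∀ i, (s i).inside ⊆ interior W) ∧ (∀ i j, (s i).1 = (s j).1 → s i = s j) ∧
      ∀ c, candidateVertex s c ∈ interior W →
        IsVertex (FinConfig.ofTuple s).points (candidateVertex s c) →
        IsTShaped (FinConfig.ofTuple s).points (candidateVertex s c) := by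
  constructor
  · rintro ⟨T, hT⟩
    have hmem : ∀ i, s i ∈ T.segments := fun i => hT ▸ FinConfig.apply_mem_points_ofTuple s i
    exact ⟨fun i => T.angle_mem _ (hmem i), fun i => T.birth_lt_death _ (hmem i),
      fun i => T.inside_subset _ (hmem i), fun i j => T.not_aligned _ (hmem i) _ (hmem j),
      fun c => hT ▸ T.tShaped (candidateVertex s c)⟩
  · rintro ⟨hangle, hlt, hinside, hline, htShaped⟩
    refine ⟨⟨(FinConfig.ofTuple s).points, ?_, ?_, ?_, ?_, fun x hx hvertex => ?_⟩, rfl⟩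
    · simpa only [FinConfig.mem_points_ofTuple, forall_exists_index, forall_apply_eq_imp_iff]
    · simpa only [FinConfig.mem_points_ofTuple, forall_exists_index, forall_apply_eq_imp_iff]
    · simpa only [FinConfig.mem_points_ofTuple, forall_exists_index, forall_apply_eq_imp_iff]
    · simpa only [FinConfig.mem_points_ofTuple, forall_exists_index, forall_apply_eq_imp_iff]
    · obtain ⟨c, rfl⟩ := exists_candidateVertex_eq hangle hline hvertex
      exact htShaped c hx hvertex

end TupleVertices

theorem measurable_mem_tessTuples {W : Set Plane} (hW : Convex ℝ W) (k : ℕ) :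
    Measurable fun p : (Fin k → LineParam) × (Fin k → SegParam) => p.2 ∈ tessTuples W p.1 := by
  have hp : ∀ i : Fin k, Measurable fun s : Fin k → SegParam => s i := measurable_pi_apply
  have htess : Measurable fun s : Fin k → SegParam =>
      ∃ T : TTessellation W, T.segments = (FinConfig.ofTuple s).points := by
    simp only [exists_segments_eq_ofTuple_iff]
    refine .and (.forall fun i => ?_) <| .and (.forall fun i => ?_) <| .and (.forall fun i => ?_) <|
      .and (.forall fun i => .forall fun j => ?_) <| .forall fun c => .imp ?_ <|
      (measurable_isVertex (measurable_candidateVertex c)).imp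
        (measurable_isTShaped (measurable_candidateVertex c))
    · exact measurableSet_setOfPred.1 ((hp i).fst.fst measurableSet_Ico)
    · exact measurableSet_setOfPred.1 (measurableSet_lt (hp i).snd.fst (hp i).snd.snd)
    · exact (measurable_inside_subset_interior hW).comp (hp i)
    · exact (measurable_eq_fun (hp i).fst (hp j).fst).imp (measurable_eq_fun (hp i) (hp j))
    · exact measurableSet_setOfPred.1 (measurable_candidateVertex c isOpen_interior.measurableSet)
  exact (htess.comp measurable_snd).and (.forall fun i => measurable_eq_fun
    ((hp i).comp measurable_snd).fst ((measurable_pi_apply i).comp measurable_fst))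

theorem measurable_codedSegment (W : Set Plane) {k : ℕ} (i : Fin k)
    (c : Option (Fin k) × Option (Fin k)) :
    Measurable fun l : Fin k → LineParam => codedSegment W l i c := by
  obtain ⟨c, d⟩ := c
  refine (measurable_pi_apply i).prodMk (Measurable.prodMk ?_ ?_)
  · cases c with
    | none => exact (measurable_entryAbscissa W).comp (measurable_pi_apply i)
    | some j => exact measurable_crossAbscissa (measurable_pi_apply i) (measurable_pi_apply j)
  · cases d with
    | none => exact (measurable_exitAbscissa W).comp (measurable_pi_apply i)
    | some j => exact measurable_crossAbscissa (measurable_pi_apply i) (measurable_pi_apply j)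

theorem tessellationsOn_apply {W : Set Plane} {k : ℕ} (l : Fin k → LineParam)
    {B : Set (FinConfig SegParam)} (hB : MeasurableSet B) :
    tessellationsOn W (FinConfig.ofTuple l)
        ((fun T : TTessellation W => (⟨T.segments⟩ : FinConfig SegParam)) ⁻¹' B) =
      ∑' s : tessTuples W l, B.indicator 1 (FinConfig.ofTuple s.1) := by
  have hpreimage : MeasurableSet
      ((fun T : TTessellation W => (⟨T.segments⟩ : FinConfig SegParam)) ⁻¹' B) := ⟨B, hB, rfl⟩
  rw [tessellationsOn, Measure.sum_apply _ hpreimage, ← (tessTuplesEquiv W l).tsum_eq]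
  refine tsum_congr fun s => ?_
  rw [Measure.dirac_apply' _ hpreimage]
  exact congrArg (fun S => B.indicator 1 (⟨S⟩ : FinConfig SegParam)) (segments_tessTuplesEquiv s)

theorem measurable_tessellationsOn {W : Set Plane} (hW : Convex ℝ W) :
    Measurable (tessellationsOn W) := by
  refine Measure.measurable_of_measurable_coe _ ?_
  rintro _ ⟨B, hB, rfl⟩
  refine FinConfig.measurable_of_comp_ofTuple fun k => ?_
  simp only [tessellationsOn_apply _ hB]
  refine measurable_tsum_of_subset_range
    (g := fun c : Fin k → Option (Fin k) × Option (Fin k) => fun l i => codedSegment W l i (c i))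
    (F := fun s => B.indicator 1 (FinConfig.ofTuple s))
    (fun c => measurable_pi_lambda _ fun i => measurable_codedSegment W i (c i))
    (measurable_mem_tessTuples hW k) (fun l s hs => ?_)
    ((measurable_one.indicator hB).comp (FinConfig.measurable_ofTuple k))
  choose c hc using exists_codedSegment_eq hW hs
  exact ⟨c, funext hc⟩

/-! ### The sweep of a tessellation -/

section MonoOrAnti

variable {α β : Type*} [LinearOrder α] [LinearOrder β] {f : α → β} {b d t : α}

theorem apply_mem_uIcc_iff (hf : StrictMono f ∨ StrictAnti f) :
    f t ∈ Set.uIcc (f b) (f d) ↔ t ∈ Set.uIcc b d := by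
  rcases hf with hf | hf
  · simp only [Set.mem_uIcc, hf.le_iff_le]
  · simp only [Set.mem_uIcc, hf.le_iff_ge]
    tauto

theorem apply_mem_uIoo_iff (hf : StrictMono f ∨ StrictAnti f) :
    f t ∈ Set.uIoo (f b) (f d) ↔ t ∈ Set.uIoo b d := by
  simp only [Set.uIoo, Set.mem_Ioo, inf_lt_iff, lt_sup_iff]
  rcases hf with hf | hf
  · simp only [hf.lt_iff_lt]
  · simp only [hf.lt_iff_gt]
    tauto

end MonoOrAnti

/-- The signed distance to the line `l`, counted positively on the side `ε` of `l`. It is the time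
at which a front leaving `l` at time `0` reaches a point on that side. -/
noncomputable def sideCoord (ε : ℤˣ) (l : LineParam) (x : Plane) : ℝ :=
  (ε : ℤ) * (normalCoord l x - l.2)

/-- The first time of the closed segment `a` when the side `ε` of the line `l` is swept from `l`,
and `0` if the segment does not enter this half-plane. -/
noncomputable def firstTime (ε : ℤˣ) (l : LineParam) (a : SegParam) : ℝ :=
  max 0 (min (sideCoord ε l (linePoint a.1 a.2.1)) (sideCoord ε l (linePoint a.1 a.2.2)))

/-- The last time of the closed segment `a` when the side `ε` of the line `l` is swept from `l`,
and `0` if the segment does not enter this half-plane. -/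
noncomputable def lastTime (ε : ℤˣ) (l : LineParam) (a : SegParam) : ℝ :=
  max 0 (max (sideCoord ε l (linePoint a.1 a.2.1)) (sideCoord ε l (linePoint a.1 a.2.2)))

section Side

variable {ε : ℤˣ} {l m : LineParam} {x : Plane}

theorem OnLine.sideCoord_eq_zero (h : OnLine l x) : sideCoord ε l x = 0 := by
  rw [sideCoord, h, sub_self, mul_zero]

theorem sideCoord_neg (ε : ℤˣ) (l : LineParam) (x : Plane) :
    sideCoord (-ε) l x = -sideCoord ε l x := by
  simp [sideCoord]

theorem sideCoord_linePoint (ε : ℤˣ) (l m : LineParam) (t : ℝ) :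
    sideCoord ε m (linePoint l t) =
      (ε : ℤ) * (l.2 * Real.cos (l.1 - m.1) - t * Real.sin (l.1 - m.1) - m.2) := by
  rw [sideCoord, normalCoord_linePoint]

namespace Nonparallel

theorem slope_ne_zero (h : Nonparallel l m) (ε : ℤˣ) :
    ((ε : ℤ) : ℝ) * Real.sin (l.1 - m.1) ≠ 0 :=
  mul_ne_zero (Int.cast_ne_zero.2 ε.ne_zero) h

theorem sideCoord_strictMono_or_strictAnti (h : Nonparallel l m) (ε : ℤˣ) :
    StrictMono (fun t => sideCoord ε m (linePoint l t)) ∨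
      StrictAnti fun t => sideCoord ε m (linePoint l t) := by
  have hsub : ∀ a b, sideCoord ε m (linePoint l b) - sideCoord ε m (linePoint l a) =
      ((ε : ℤ) * Real.sin (l.1 - m.1)) * (a - b) := fun a b => by
    simp only [sideCoord_linePoint]
    ring
  rcases (h.slope_ne_zero ε).lt_or_gt with h0 | h0
  · exact Or.inl fun a b hab => sub_pos.1 (hsub a b ▸ mul_pos_of_neg_of_neg h0 (sub_neg.2 hab))
  · exact Or.inr fun a b hab => sub_neg.1 (hsub a b ▸ mul_neg_of_pos_of_neg h0 (sub_neg.2 hab))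

theorem sideCoord_injective (h : Nonparallel l m) (ε : ℤˣ) :
    Function.Injective fun t => sideCoord ε m (linePoint l t) :=
  (h.sideCoord_strictMono_or_strictAnti ε).elim StrictMono.injective StrictAnti.injective

theorem sideCoord_surjective (h : Nonparallel l m) (ε : ℤˣ) :
    Function.Surjective fun t => sideCoord ε m (linePoint l t) := fun u => by
  refine ⟨((ε : ℤ) * (l.2 * Real.cos (l.1 - m.1) - m.2) - u) /
    ((ε : ℤ) * Real.sin (l.1 - m.1)), ?_⟩
  simp only [sideCoord_linePoint]
  linear_combination -div_mul_cancel₀ ((ε : ℤ) * (l.2 * Real.cos (l.1 - m.1) - m.2) - u)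
    (h.slope_ne_zero ε)

theorem eq_of_sideCoord_eq (h : Nonparallel l m) {y : Plane} (hx : OnLine l x) (hy : OnLine l y)
    (hxy : sideCoord ε m x = sideCoord ε m y) : x = y := by
  rw [← hx.linePoint_tangentCoord, ← hy.linePoint_tangentCoord] at hxy ⊢
  rw [h.sideCoord_injective ε hxy]

end Nonparallel

end Side

section Times

variable {ε : ℤˣ} {m : LineParam} {a a' : SegParam} {x : Plane}

theorem mem_carrier_iff_sideCoord (hm : Nonparallel a.1 m) (ha : a.2.1 ≤ a.2.2)
    (hx : OnLine a.1 x) : x ∈ a.carrier ↔ sideCoord ε m x ∈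
      Set.uIcc (sideCoord ε m (linePoint a.1 a.2.1)) (sideCoord ε m (linePoint a.1 a.2.2)) := by
  have h := apply_mem_uIcc_iff (b := a.2.1) (d := a.2.2) (t := tangentCoord a.1 x)
    (hm.sideCoord_strictMono_or_strictAnti ε)
  simp only [hx.linePoint_tangentCoord] at h
  rw [h, Set.uIcc_of_le ha, SegParam.mem_carrier, and_iff_right hx]

theorem mem_inside_iff_sideCoord (hm : Nonparallel a.1 m) (ha : a.2.1 ≤ a.2.2)
    (hx : OnLine a.1 x) : x ∈ a.inside ↔ sideCoord ε m x ∈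
      Set.uIoo (sideCoord ε m (linePoint a.1 a.2.1)) (sideCoord ε m (linePoint a.1 a.2.2)) := by
  have h := apply_mem_uIoo_iff (b := a.2.1) (d := a.2.2) (t := tangentCoord a.1 x)
    (hm.sideCoord_strictMono_or_strictAnti ε)
  simp only [hx.linePoint_tangentCoord] at h
  rw [h, Set.uIoo_of_le ha, SegParam.mem_inside, and_iff_right hx]

theorem mem_ends_iff_sideCoord (hm : Nonparallel a.1 m) (hx : OnLine a.1 x) :
    x ∈ a.ends ↔ sideCoord ε m x = sideCoord ε m (linePoint a.1 a.2.1) ∨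
      sideCoord ε m x = sideCoord ε m (linePoint a.1 a.2.2) := by
  have hiff : ∀ t, sideCoord ε m x = sideCoord ε m (linePoint a.1 t) ↔ tangentCoord a.1 x = t :=
    fun t => by simpa only [hx.linePoint_tangentCoord] using
      (hm.sideCoord_injective ε).eq_iff (a := tangentCoord a.1 x) (b := t)
  rw [SegParam.mem_ends, and_iff_right hx, hiff, hiff]

theorem mem_carrier_iff_times (hm : Nonparallel a.1 m) (ha : a.2.1 ≤ a.2.2) (hx : OnLine a.1 x)
    (hpos : 0 < sideCoord ε m x) :
    x ∈ a.carrier ↔ sideCoord ε m x ∈ Set.Icc (firstTime ε m a) (lastTime ε m a) := by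
  rw [mem_carrier_iff_sideCoord (ε := ε) hm ha hx, firstTime, lastTime]
  simp only [Set.uIcc, Set.mem_Icc, max_le_iff, le_max_iff, hpos.le, hpos.not_ge, true_and,
    false_or]

theorem mem_inside_iff_times (hm : Nonparallel a.1 m) (ha : a.2.1 ≤ a.2.2) (hx : OnLine a.1 x)
    (hpos : 0 < sideCoord ε m x) :
    x ∈ a.inside ↔ sideCoord ε m x ∈ Set.Ioo (firstTime ε m a) (lastTime ε m a) := by
  rw [mem_inside_iff_sideCoord (ε := ε) hm ha hx, firstTime, lastTime]
  simp only [Set.uIoo, Set.mem_Ioo, max_lt_iff, lt_max_iff, hpos, hpos.not_gt, true_and, false_or]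

theorem mem_ends_iff_times (hm : Nonparallel a.1 m) (hx : OnLine a.1 x)
    (hpos : 0 < sideCoord ε m x) :
    x ∈ a.ends ↔ sideCoord ε m x = firstTime ε m a ∨ sideCoord ε m x = lastTime ε m a := by
  rw [mem_ends_iff_sideCoord (ε := ε) hm hx, firstTime, lastTime]
  grind

theorem firstTime_nonneg : 0 ≤ firstTime ε m a := le_max_left _ _

theorem firstTime_eq_zero_of_onLine_of_mem_carrier (hm : Nonparallel a.1 m) (ha : a.2.1 ≤ a.2.2)
    (hxa : x ∈ a.carrier) (hxm : OnLine m x) : firstTime ε m a = 0 := by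
  have h := (mem_carrier_iff_sideCoord (ε := ε) hm ha (SegParam.mem_carrier.1 hxa).1).1 hxa
  rw [hxm.sideCoord_eq_zero] at h
  exact max_eq_left h.1

theorem firstTime_eq_zero_or_neg (ε : ℤˣ) (m : LineParam) (a : SegParam) :
    firstTime ε m a = 0 ∨ firstTime (-ε) m a = 0 := by
  simp only [firstTime, sideCoord_neg]
  grind

theorem firstTime_lt_lastTime_or (hm : Nonparallel a.1 m) (ha : a.2.1 < a.2.2) :
    firstTime ε m a < lastTime ε m a ∨ (firstTime ε m a = 0 ∧ lastTime ε m a = 0) := by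
  have hne : sideCoord ε m (linePoint a.1 a.2.1) ≠ sideCoord ε m (linePoint a.1 a.2.2) :=
    fun h => ha.ne (hm.sideCoord_injective ε h)
  have hlt := min_lt_max.2 hne
  rw [firstTime, lastTime]
  grind

theorem firstTime_eq_zero_of_eq (ha : a.1 = m) : firstTime ε m a = 0 := by
  subst ha
  simp [firstTime, (onLine_linePoint a.1 _).sideCoord_eq_zero]

theorem lastTime_eq_zero_of_eq (ha : a.1 = m) : lastTime ε m a = 0 := by
  subst ha
  simp [lastTime, (onLine_linePoint a.1 _).sideCoord_eq_zero]

theorem min_sideCoord_eq_sub (ε : ℤˣ) (m : LineParam) (a : SegParam) :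
    min (sideCoord ε m (linePoint a.1 a.2.1)) (sideCoord ε m (linePoint a.1 a.2.2)) =
      firstTime ε m a - lastTime (-ε) m a := by
  simp only [firstTime, lastTime, sideCoord_neg, max_neg_neg, max_comm (0 : ℝ),
    max_zero_sub_max_neg_zero_eq_self]

theorem max_sideCoord_eq_sub (ε : ℤˣ) (m : LineParam) (a : SegParam) :
    max (sideCoord ε m (linePoint a.1 a.2.1)) (sideCoord ε m (linePoint a.1 a.2.2)) =
      lastTime ε m a - firstTime (-ε) m a := by
  simp only [firstTime, lastTime, sideCoord_neg, min_neg_neg, max_comm (0 : ℝ),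
    max_zero_sub_max_neg_zero_eq_self]

theorem eq_of_times_eq (hline : a.1 = a'.1) (hm : Nonparallel a.1 m) (ha : a.2.1 ≤ a.2.2)
    (ha' : a'.2.1 ≤ a'.2.2) (hfirst : ∀ ε, firstTime ε m a = firstTime ε m a')
    (hlast : ∀ ε, lastTime ε m a = lastTime ε m a') : a = a' := by
  have hcarrier : ∀ t, linePoint a.1 t ∈ a.carrier ↔ linePoint a.1 t ∈ a'.carrier := fun t => by
    rw [mem_carrier_iff_sideCoord (ε := 1) hm ha (onLine_linePoint _ _),
      mem_carrier_iff_sideCoord (ε := 1) (hline ▸ hm) ha' (hline ▸ onLine_linePoint _ _)]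
    simp only [Set.uIcc, min_sideCoord_eq_sub, max_sideCoord_eq_sub, hfirst, hlast]
  have hIcc : Set.Icc a.2.1 a.2.2 = Set.Icc a'.2.1 a'.2.2 := Set.ext fun t => by
    simpa only [SegParam.mem_carrier, ← hline, onLine_linePoint, tangentCoord_linePoint, true_and]
      using hcarrier t
  obtain ⟨hb, hd⟩ := (Set.Icc_eq_Icc_iff ha).1 hIcc
  exact Prod.ext hline (Prod.ext hb hd)

end Times

section Sweep

variable {W : Set Plane} {k : ℕ} {l : Fin k → LineParam} {s : Fin k → SegParam} {ε : ℤˣ}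

/-- The lines `l` seen by a front that sweeps the side `ε` of the line `l i₀` from that line on. -/
def sweptLines (hW : Convex ℝ W) (hl : Pairwise fun i j => Nonparallel (l i) (l j)) (ε : ℤˣ)
    (i₀ : Fin k) : SweptLines (Fin k) where
  MeetAt i j t := i ≠ j ∧ ∃ x, OnLine (l i) x ∧ OnLine (l j) x ∧ sideCoord ε (l i₀) x = t
  meetAt_unique := by
    rintro i j _ _ ⟨hij, x, hxi, hxj, rfl⟩ ⟨-, y, hyi, hyj, rfl⟩
    rw [(hl hij).eq_of_onLine hxi hxj hyi hyj]
  inner i := {t | ∃ x ∈ interior W, OnLine (l i) x ∧ sideCoord ε (l i₀) x = t}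
  ordConnected_inner i := Convex.ordConnected <| by
    rintro _ ⟨x, hxW, hx, rfl⟩ _ ⟨y, hyW, hy, rfl⟩ u v hu hv huv
    refine ⟨u • x + v • y, hW.interior hxW hyW hu hv huv, ?_, ?_⟩
    · simp only [OnLine, normalCoord, PiLp.add_apply, PiLp.smul_apply, smul_eq_mul] at hx hy ⊢
      linear_combination u * hx + v * hy + (l i).2 * huv
    · simp only [sideCoord, normalCoord, PiLp.add_apply, PiLp.smul_apply, smul_eq_mul]
      linear_combination ((ε : ℤ) * (l i₀).2) * huv

theorem nonparallel_of_sideCoord_pos (hl : Pairwise fun i j => Nonparallel (l i) (l j))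
    {i i₀ : Fin k} {x : Plane} (hx : OnLine (l i) x) (hpos : 0 < sideCoord ε (l i₀) x) :
    Nonparallel (l i) (l i₀) :=
  hl fun h => hpos.ne' (h ▸ hx).sideCoord_eq_zero

theorem injective_of_mem_tessTuples (hs : s ∈ tessTuples W l)
    (hl : Pairwise fun i j => Nonparallel (l i) (l j)) : Function.Injective s := fun i j hij => by
  by_contra hne
  exact (hl hne).ne (by rw [← hs.2, ← hs.2, hij])

theorem lt_of_mem_tessTuples (hs : s ∈ tessTuples W l) (i : Fin k) : (s i).2.1 < (s i).2.2 := by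
  obtain ⟨T, hT⟩ := exists_mem_segments_iff_of_mem_tessTuples hs
  exact T.birth_lt_death _ ((hT _).2 ⟨i, rfl⟩)

section Times

variable {i i₀ : Fin k} {x : Plane}

theorem mem_carrier_iff_times_of_mem_tessTuples (hs : s ∈ tessTuples W l)
    (hl : Pairwise fun i j => Nonparallel (l i) (l j)) (hx : OnLine (l i) x)
    (hpos : 0 < sideCoord ε (l i₀) x) : x ∈ (s i).carrier ↔ sideCoord ε (l i₀) x ∈
      Set.Icc (firstTime ε (l i₀) (s i)) (lastTime ε (l i₀) (s i)) :=
  mem_carrier_iff_times (hs.2 i ▸ nonparallel_of_sideCoord_pos hl hx hpos)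
    (lt_of_mem_tessTuples hs i).le (hs.2 i ▸ hx) hpos

theorem mem_inside_iff_times_of_mem_tessTuples (hs : s ∈ tessTuples W l)
    (hl : Pairwise fun i j => Nonparallel (l i) (l j)) (hx : OnLine (l i) x)
    (hpos : 0 < sideCoord ε (l i₀) x) : x ∈ (s i).inside ↔ sideCoord ε (l i₀) x ∈
      Set.Ioo (firstTime ε (l i₀) (s i)) (lastTime ε (l i₀) (s i)) :=
  mem_inside_iff_times (hs.2 i ▸ nonparallel_of_sideCoord_pos hl hx hpos)
    (lt_of_mem_tessTuples hs i).le (hs.2 i ▸ hx) hpos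

theorem mem_ends_iff_times_of_mem_tessTuples (hs : s ∈ tessTuples W l)
    (hl : Pairwise fun i j => Nonparallel (l i) (l j)) (hx : OnLine (l i) x)
    (hpos : 0 < sideCoord ε (l i₀) x) : x ∈ (s i).ends ↔
      sideCoord ε (l i₀) x = firstTime ε (l i₀) (s i) ∨
        sideCoord ε (l i₀) x = lastTime ε (l i₀) (s i) :=
  mem_ends_iff_times (hs.2 i ▸ nonparallel_of_sideCoord_pos hl hx hpos) (hs.2 i ▸ hx) hpos

end Times

theorem firstTime_lt_lastTime_or_of_mem_tessTuples (hs : s ∈ tessTuples W l)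
    (hl : Pairwise fun i j => Nonparallel (l i) (l j)) (i i₀ : Fin k) :
    firstTime ε (l i₀) (s i) < lastTime ε (l i₀) (s i) ∨
      (firstTime ε (l i₀) (s i) = 0 ∧ lastTime ε (l i₀) (s i) = 0) := by
  rcases eq_or_ne i i₀ with rfl | hne
  · exact Or.inr ⟨firstTime_eq_zero_of_eq (hs.2 i), lastTime_eq_zero_of_eq (hs.2 i)⟩
  · exact firstTime_lt_lastTime_or (hs.2 i ▸ hl hne) (lt_of_mem_tessTuples hs i)

theorem Ioo_times_subset_inner (hW : Convex ℝ W) (hs : s ∈ tessTuples W l)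
    (hl : Pairwise fun i j => Nonparallel (l i) (l j)) (i i₀ : Fin k) :
    Set.Ioo (firstTime ε (l i₀) (s i)) (lastTime ε (l i₀) (s i)) ⊆
      (sweptLines hW hl ε i₀).inner i := by
  intro t ht
  have hne : i ≠ i₀ := by
    rintro rfl
    rw [firstTime_eq_zero_of_eq (hs.2 i), lastTime_eq_zero_of_eq (hs.2 i)] at ht
    exact (ht.1.trans ht.2).false
  obtain ⟨u, rfl⟩ := (hl hne).sideCoord_surjective ε t
  obtain ⟨T, hT⟩ := exists_mem_segments_iff_of_mem_tessTuples hs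
  exact ⟨_, T.inside_subset _ ((hT _).2 ⟨i, rfl⟩) ((mem_inside_iff_times_of_mem_tessTuples hs hl
    (onLine_linePoint _ u) (firstTime_nonneg.trans_lt ht.1)).2 ht), onLine_linePoint _ u, rfl⟩

theorem mem_Ioo_times_of_meetAt (hW : Convex ℝ W) (hs : s ∈ tessTuples W l)
    (hl : Pairwise fun i j => Nonparallel (l i) (l j)) {i j i₀ : Fin k} {t : ℝ} (hpos : 0 < t)
    (hmeet : (sweptLines hW hl ε i₀).MeetAt i j t) (hinner : t ∈ (sweptLines hW hl ε i₀).inner i)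
    (hi : t ∈ Set.Icc (firstTime ε (l i₀) (s i)) (lastTime ε (l i₀) (s i)))
    (hj : t ∈ Set.Icc (firstTime ε (l i₀) (s j)) (lastTime ε (l i₀) (s j))) :
    (t ∈ Set.Ioo (firstTime ε (l i₀) (s i)) (lastTime ε (l i₀) (s i)) ∧
      (t = firstTime ε (l i₀) (s j) ∨ t = lastTime ε (l i₀) (s j))) ∨
    (t ∈ Set.Ioo (firstTime ε (l i₀) (s j)) (lastTime ε (l i₀) (s j)) ∧
      (t = firstTime ε (l i₀) (s i) ∨ t = lastTime ε (l i₀) (s i))) := by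
  obtain ⟨hij, x, hxi, hxj, rfl⟩ := hmeet
  obtain ⟨y, hyW, hyi, hyx⟩ := hinner
  obtain rfl := (nonparallel_of_sideCoord_pos hl hxi hpos).eq_of_sideCoord_eq hyi hxi hyx
  obtain ⟨T, hT⟩ := exists_mem_segments_iff_of_mem_tessTuples hs
  rw [← mem_inside_iff_times_of_mem_tessTuples hs hl hxi hpos,
    ← mem_inside_iff_times_of_mem_tessTuples hs hl hxj hpos,
    ← mem_ends_iff_times_of_mem_tessTuples hs hl hxi hpos,
    ← mem_ends_iff_times_of_mem_tessTuples hs hl hxj hpos]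
  exact T.mem_inside_and_mem_ends_of_mem_carrier ((hT _).2 ⟨i, rfl⟩) ((hT _).2 ⟨j, rfl⟩)
    ((injective_of_mem_tessTuples hs hl).ne hij) hyW
    ((mem_carrier_iff_times_of_mem_tessTuples hs hl hxi hpos).2 hi)
    ((mem_carrier_iff_times_of_mem_tessTuples hs hl hxj hpos).2 hj)

theorem exists_meetAt_of_eq_times (hW : Convex ℝ W) (hs : s ∈ tessTuples W l)
    (hl : Pairwise fun i j => Nonparallel (l i) (l j)) {i i₀ : Fin k} {t : ℝ} (hpos : 0 < t)
    (hinner : t ∈ (sweptLines hW hl ε i₀).inner i)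
    (hend : t = firstTime ε (l i₀) (s i) ∨ t = lastTime ε (l i₀) (s i)) :
    ∃ j, (sweptLines hW hl ε i₀).MeetAt i j t ∧
      t ∈ Set.Ioo (firstTime ε (l i₀) (s j)) (lastTime ε (l i₀) (s j)) := by
  obtain ⟨x, hxW, hx, rfl⟩ := hinner
  obtain ⟨T, hT⟩ := exists_mem_segments_iff_of_mem_tessTuples hs
  obtain ⟨_, hb, hne, hxb⟩ := T.exists_mem_inside_of_mem_ends ((hT _).2 ⟨i, rfl⟩)
    ((mem_ends_iff_times_of_mem_tessTuples hs hl hx hpos).2 hend) hxW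
  obtain ⟨j, rfl⟩ := (hT _).1 hb
  have hxj : OnLine (l j) x := hs.2 j ▸ (SegParam.mem_inside.1 hxb).1
  exact ⟨j, ⟨fun h => hne (congrArg s h), x, hx, hxj, rfl⟩,
    (mem_inside_iff_times_of_mem_tessTuples hs hl hxj hpos).1 hxb⟩

theorem eq_of_meetAt_lastTime (hW : Convex ℝ W) (hs : s ∈ tessTuples W l)
    (hl : Pairwise fun i j => Nonparallel (l i) (l j)) {i i' j i₀ : Fin k}
    (hij : (sweptLines hW hl ε i₀).MeetAt i j (lastTime ε (l i₀) (s j)))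
    (hij' : (sweptLines hW hl ε i₀).MeetAt i' j (lastTime ε (l i₀) (s j)))
    (hinner : lastTime ε (l i₀) (s j) ∈ (sweptLines hW hl ε i₀).inner j)
    (hi : lastTime ε (l i₀) (s j) ∈
      Set.Ioo (firstTime ε (l i₀) (s i)) (lastTime ε (l i₀) (s i)))
    (hi' : lastTime ε (l i₀) (s j) ∈
      Set.Ioo (firstTime ε (l i₀) (s i')) (lastTime ε (l i₀) (s i'))) : i = i' := by
  obtain ⟨x, hxW, hx, hxt⟩ := hinner
  obtain ⟨-, y, hyi, hyj, hyt⟩ := hij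
  obtain ⟨-, z, hzi, hzj, hzt⟩ := hij'
  have hpos : 0 < sideCoord ε (l i₀) x := hxt ▸ firstTime_nonneg.trans_lt hi.1
  have hj := nonparallel_of_sideCoord_pos hl hx hpos
  obtain rfl := hj.eq_of_sideCoord_eq hx hyj (hxt.trans hyt.symm)
  obtain rfl := hj.eq_of_sideCoord_eq hx hzj (hxt.trans hzt.symm)
  rw [← hxt, ← mem_inside_iff_times_of_mem_tessTuples hs hl ‹_› hpos] at hi hi'
  obtain ⟨T, hT⟩ := exists_mem_segments_iff_of_mem_tessTuples hs
  exact injective_of_mem_tessTuples hs hl <| T.eq_of_mem_inside_of_mem_ends ((hT _).2 ⟨i, rfl⟩)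
    ((hT _).2 ⟨i', rfl⟩) ((hT _).2 ⟨j, rfl⟩) hxW
    ((mem_ends_iff_times_of_mem_tessTuples hs hl hx hpos).2 (Or.inr hxt)) hi hi'

theorem isSweep_of_mem_tessTuples (hW : Convex ℝ W) (hs : s ∈ tessTuples W l)
    (hl : Pairwise fun i j => Nonparallel (l i) (l j)) (ε : ℤˣ) (i₀ : Fin k) :
    (sweptLines hW hl ε i₀).IsSweep (fun i => firstTime ε (l i₀) (s i))
      fun i => lastTime ε (l i₀) (s i) where
  nonneg _ := firstTime_nonneg
  lt_or_absent i := firstTime_lt_lastTime_or_of_mem_tessTuples hs hl i i₀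
  Ioo_subset i := Ioo_times_subset_inner hW hs hl i i₀
  meet := mem_Ioo_times_of_meetAt hW hs hl
  birth _ hpos hinner := exists_meetAt_of_eq_times hW hs hl hpos hinner (Or.inl rfl)
  death _ hpos hinner := exists_meetAt_of_eq_times hW hs hl hpos hinner (Or.inr rfl)
  host_unique := eq_of_meetAt_lastTime hW hs hl

end Sweep

/-! ### Counting the tessellations on given lines -/

section Words

variable {ι κ : Type*} [Fintype ι] [DecidableEq ι]

theorem card_mul_le_sum_pow {A : Finset κ} {P : Finset (ι → κ)} {φ : κ → ℝ} {c : ℝ}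
    (hA : P ⊆ Fintype.piFinset fun _ => A) (hφ : ∀ a, 0 ≤ φ a) (hc : ∀ f ∈ P, c ≤ ∏ i, φ (f i)) :
    P.card * c ≤ (∑ a ∈ A, φ a) ^ Fintype.card ι := by
  calc (P.card : ℝ) * c = P.card • c := (nsmul_eq_mul _ _).symm
    _ ≤ ∑ f ∈ P, ∏ i, φ (f i) := Finset.card_nsmul_le_sum P _ c hc
    _ ≤ ∑ f ∈ Fintype.piFinset fun _ => A, ∏ i, φ (f i) :=
      Finset.sum_le_sum_of_subset_of_nonneg hA fun f _ _ => Finset.prod_nonneg fun i _ => hφ _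
    _ = ∏ _i : ι, ∑ a ∈ A, φ a := (Finset.prod_univ_sum _ _).symm
    _ = (∑ a ∈ A, φ a) ^ Fintype.card ι := by rw [Finset.prod_const, Finset.card_univ]

/-- The words that can encode births: a letter tells whether a segment has a last time `0` and gives
its birth rank, at most `r`, unless its first time is `0`. This last case occurs for at least `n`
letters. -/
def birthWords (ι : Type*) [Fintype ι] [DecidableEq ι] (r n : ℕ) :
    Finset (ι → Bool × Option ℕ) :=
  {f ∈ Fintype.piFinset fun _ => Finset.univ ×ˢ (Finset.range (r + 1)).insertNone |
    n ≤ Finset.card {i | (f i).2 = none}}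

/-- The words that can encode numbers of kills. -/
def killWords (ι : Type*) [Fintype ι] [DecidableEq ι] : Finset (ι → ℕ) :=
  {f ∈ Fintype.piFinset fun _ => Finset.range (Fintype.card ι + 1) | ∑ i, f i ≤ Fintype.card ι}

theorem card_birthWords_mul_le (r n : ℕ) :
    ((birthWords ι r n).card : ℝ) * (r + 1) ^ n ≤ (4 * (r + 1)) ^ Fintype.card ι := by
  have hweight : ∑ a ∈ (Finset.univ : Finset Bool) ×ˢ (Finset.range (r + 1)).insertNone,
      (if a.2 = none then (r + 1 : ℝ) else 1) = 4 * (r + 1) := by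
    simp [Finset.sum_product]
    ring
  rw [← hweight]
  refine card_mul_le_sum_pow (Finset.filter_subset _ _)
    (fun a => by split_ifs <;> positivity) fun f hf => ?_
  rw [Finset.prod_ite, Finset.prod_const, Finset.prod_const_one, mul_one]
  exact pow_le_pow_right₀ (by simp) (Finset.mem_filter.1 hf).2

theorem card_killWords_le (ι : Type*) [Fintype ι] [DecidableEq ι] :
    ((killWords ι).card : ℝ) ≤ 4 ^ Fintype.card ι := by
  have hcard : ((killWords ι).card : ℝ) * (1 / 2) ^ Fintype.card ι ≤ 2 ^ Fintype.card ι := by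
    refine (card_mul_le_sum_pow (φ := fun a => (1 / 2) ^ a) (Finset.filter_subset _ _)
      (fun a => by positivity) fun f hf => ?_).trans
      (pow_le_pow_left₀ (by positivity) (sum_geometric_two_le _) _)
    rw [Finset.prod_pow_eq_pow_sum]
    exact pow_le_pow_of_le_one (by norm_num) (by norm_num) (Finset.mem_filter.1 hf).2
  calc ((killWords ι).card : ℝ)
      = (killWords ι).card * (1 / 2) ^ Fintype.card ι * 2 ^ Fintype.card ι := by
        rw [mul_assoc, ← mul_pow]
        norm_num
    _ ≤ 2 ^ Fintype.card ι * 2 ^ Fintype.card ι := by gcongr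
    _ = 4 ^ Fintype.card ι := by
        rw [← mul_pow]
        norm_num

end Words

section Count

variable {W : Set Plane} {k : ℕ} {l : Fin k → LineParam} {s s' : Fin k → SegParam}

/-- The segments met by the line `l i`, other than the segment of this line. -/
noncomputable def hitSegments (l : Fin k → LineParam) (s : Fin k → SegParam) (i : Fin k) :
    Finset (Fin k) := by
  classical exact {j | j ≠ i ∧ ∃ x ∈ (s j).carrier, OnLine (l i) x}

theorem mem_hitSegments {i j : Fin k} :
    j ∈ hitSegments l s i ↔ j ≠ i ∧ ∃ x ∈ (s j).carrier, OnLine (l i) x := by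
  simp [hitSegments]

theorem firstTime_eq_zero_of_mem_hitSegments (hs : s ∈ tessTuples W l)
    (hl : Pairwise fun i j => Nonparallel (l i) (l j)) {i j : Fin k} (hj : j ∈ hitSegments l s i)
    (ε : ℤˣ) : firstTime ε (l i) (s j) = 0 := by
  obtain ⟨hne, x, hx, hxi⟩ := mem_hitSegments.1 hj
  exact firstTime_eq_zero_of_onLine_of_mem_carrier (hs.2 j ▸ hl hne)
    (lt_of_mem_tessTuples hs j).le hx hxi

/-- Every segment avoids the interior of one of the two half-planes, and those that meet the line
`l i₀` have first time `0` on both sides. -/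
theorem add_card_hitSegments_le (hs : s ∈ tessTuples W l)
    (hl : Pairwise fun i j => Nonparallel (l i) (l j)) (i₀ : Fin k) :
    k + (hitSegments l s i₀).card ≤
      Finset.card {p : Fin k × ℤˣ | firstTime p.2 (l i₀) (s p.1) = 0} := by
  classical
  have hside : ∀ i, 1 + (if i ∈ hitSegments l s i₀ then 1 else 0) ≤
      ∑ ε : ℤˣ, if firstTime ε (l i₀) (s i) = 0 then 1 else 0 := fun i => by
    rw [UnitsInt.univ, Finset.sum_pair (by decide)]
    by_cases hi : i ∈ hitSegments l s i₀
    · simp only [hi, firstTime_eq_zero_of_mem_hitSegments hs hl hi, if_true, le_refl]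
    · rcases firstTime_eq_zero_or_neg 1 (l i₀) (s i) with h | h <;> simp [hi, h]
  calc k + (hitSegments l s i₀).card
      = ∑ i, (1 + if i ∈ hitSegments l s i₀ then 1 else 0) := by
        simp [Finset.sum_add_distrib]
    _ ≤ ∑ i, ∑ ε : ℤˣ, if firstTime ε (l i₀) (s i) = 0 then 1 else 0 :=
        Finset.sum_le_sum fun i _ => hside i
    _ = Finset.card {p : Fin k × ℤˣ | firstTime p.2 (l i₀) (s p.1) = 0} := by
        rw [Finset.card_filter, Fintype.sum_prod_type]

section Encoding

variable (hW : Convex ℝ W) (hl : Pairwise fun i j => Nonparallel (l i) (l j)) (i₀ : Fin k)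

/-- The segments that the line `l i` meets before the birth of `s i`, when the side `ε` of the line
`l i₀` is swept. -/
noncomputable def metSegments (s : Fin k → SegParam) (p : Fin k × ℤˣ) : Finset (Fin k) :=
  (sweptLines hW hl p.2 i₀).metBeforeBirth (fun i => firstTime p.2 (l i₀) (s i))
    (fun i => lastTime p.2 (l i₀) (s i)) p.1

/-- The word of the births of the segments `s` in the two sweeps from the line `l i₀`. -/
noncomputable def birthWord (s : Fin k → SegParam) (p : Fin k × ℤˣ) : Bool × Option ℕ := by
  classical exact (decide (lastTime p.2 (l i₀) (s p.1) = 0),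
    if firstTime p.2 (l i₀) (s p.1) = 0 then none else some (metSegments hW hl i₀ s p).card)

/-- The word of the numbers of kills of the segments `s` in the two sweeps from the line `l i₀`. -/
noncomputable def killWord (s : Fin k → SegParam) (p : Fin k × ℤˣ) : ℕ :=
  ((sweptLines hW hl p.2 i₀).kills (fun i => firstTime p.2 (l i₀) (s i))
    (fun i => lastTime p.2 (l i₀) (s i)) p.1).card

theorem metSegments_subset_hitSegments (hs : s ∈ tessTuples W l) (p : Fin k × ℤˣ) :
    metSegments hW hl i₀ s p ⊆ hitSegments l s p.1 := fun j hj => by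
  obtain ⟨_, ⟨hpos, -⟩, ⟨hij, x, hx, hxj, rfl⟩, -, hj⟩ := SweptLines.mem_metBeforeBirth.1 hj
  exact mem_hitSegments.2
    ⟨hij.symm, x, (mem_carrier_iff_times_of_mem_tessTuples hs hl hxj hpos).2 hj, hx⟩

theorem metSegments_eq_empty {p : Fin k × ℤˣ} (hp : firstTime p.2 (l i₀) (s p.1) = 0) :
    metSegments hW hl i₀ s p = ∅ := Finset.eq_empty_of_forall_notMem fun j hj => by
  obtain ⟨t, ht, -⟩ := SweptLines.mem_metBeforeBirth.1 hj
  exact (ht.1.trans_le ht.2).ne' hp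

theorem birthWord_mem_birthWords (hs : s ∈ tessTuples W l) {m : ℕ}
    (hmax : ∀ i, (hitSegments l s i).card ≤ m) (hm : m ≤ (hitSegments l s i₀).card) :
    birthWord hW hl i₀ s ∈ birthWords (Fin k × ℤˣ) m (k + m) := by
  have hrank : ∀ p, (metSegments hW hl i₀ s p).card ≤ m := fun p =>
    (Finset.card_le_card (metSegments_subset_hitSegments hW hl i₀ hs p)).trans (hmax p.1)
  refine Finset.mem_filter.2 ⟨Fintype.mem_piFinset.2 fun p => ?_, ?_⟩
  · by_cases hp : firstTime p.2 (l i₀) (s p.1) = 0 <;> simp [birthWord, hp, em, hrank p]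
  · refine (Nat.add_le_add_left hm k).trans ((add_card_hitSegments_le hs hl i₀).trans_eq ?_)
    congr 1
    ext p
    simp [birthWord]

theorem killWord_mem_killWords (hs : s ∈ tessTuples W l) :
    killWord hW hl i₀ s ∈ killWords (Fin k × ℤˣ) := by
  have hsum : ∑ p, killWord hW hl i₀ s p ≤ Fintype.card (Fin k × ℤˣ) := by
    rw [Fintype.sum_prod_type_right, Fintype.card_prod, mul_comm, ← smul_eq_mul]
    exact Finset.sum_le_card_nsmul _ _ _ fun ε _ =>
      (isSweep_of_mem_tessTuples hW hs hl ε i₀).sum_card_kills_le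
  refine Finset.mem_filter.2 ⟨Fintype.mem_piFinset.2 fun p => ?_, hsum⟩
  exact Finset.mem_range_succ_iff.2
    ((Finset.single_le_sum (fun _ _ => Nat.zero_le _) (Finset.mem_univ p)).trans hsum)

theorem eq_of_words_eq (hs : s ∈ tessTuples W l) (hs' : s' ∈ tessTuples W l) (h₀ : s i₀ = s' i₀)
    (hbirth : birthWord hW hl i₀ s = birthWord hW hl i₀ s')
    (hkill : killWord hW hl i₀ s = killWord hW hl i₀ s') : s = s' := by
  have hletter : ∀ p, (lastTime p.2 (l i₀) (s p.1) = 0 ↔ lastTime p.2 (l i₀) (s' p.1) = 0) ∧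
      (firstTime p.2 (l i₀) (s p.1) = 0 ↔ firstTime p.2 (l i₀) (s' p.1) = 0) ∧
      (metSegments hW hl i₀ s p).card = (metSegments hW hl i₀ s' p).card := fun p => by
    have hp := congrFun hbirth p
    simp only [birthWord, Prod.mk.injEq, decide_eq_decide] at hp
    refine ⟨hp.1, ?_⟩
    by_cases h : firstTime p.2 (l i₀) (s p.1) = 0 <;>
      by_cases h' : firstTime p.2 (l i₀) (s' p.1) = 0 <;>
      simp_all [metSegments_eq_empty]
  have htimes := fun ε => (isSweep_of_mem_tessTuples hW hs hl ε i₀).eq_of_card_eq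
    (isSweep_of_mem_tessTuples hW hs' hl ε i₀) (fun i => (hletter (i, ε)).2.1)
    (fun i => (hletter (i, ε)).1) (fun i => (hletter (i, ε)).2.2) fun i => congrFun hkill (i, ε)
  funext i
  rcases eq_or_ne i i₀ with rfl | hne
  · exact h₀
  · exact eq_of_times_eq ((hs.2 i).trans (hs'.2 i).symm) (hs.2 i ▸ hl hne)
      (lt_of_mem_tessTuples hs i).le (lt_of_mem_tessTuples hs' i).le
      (fun ε => congrFun (htimes ε).1 i) fun ε => congrFun (htimes ε).2 i

end Encoding

/-- The tuples of segments for which the line `l i₀` meets `m` of the other segments, and no line of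
the tuple meets more of them. -/
def tessTuplesMaxHit (W : Set Plane) (l : Fin k → LineParam) (i₀ : Fin k) (m : ℕ) :
    Set (Fin k → SegParam) :=
  {s ∈ tessTuples W l | (hitSegments l s i₀).card = m ∧ ∀ i, (hitSegments l s i).card ≤ m}

theorem ncard_tessTuplesMaxHit_le_card (hW : Convex ℝ W)
    (hl : Pairwise fun i j => Nonparallel (l i) (l j)) (i₀ : Fin k) (m : ℕ) :
    (tessTuplesMaxHit W l i₀ m).ncard ≤ (k + 1) ^ 2 *
      ((birthWords (Fin k × ℤˣ) m (k + m)).card * (killWords (Fin k × ℤˣ)).card) := by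
  classical
  let segments := (Finset.univ : Finset (Option (Fin k) × Option (Fin k))).image
    (codedSegment W l i₀)
  have hsegments : segments.card ≤ (k + 1) ^ 2 := Finset.card_image_le.trans (by simp [sq])
  let codes := segments ×ˢ birthWords (Fin k × ℤˣ) m (k + m) ×ˢ killWords (Fin k × ℤˣ)
  have hcodes : (tessTuplesMaxHit W l i₀ m).ncard ≤ codes.card := by
    rw [← Set.ncard_coe_finset]
    refine Set.ncard_le_ncard_of_injOn
      (fun s => (s i₀, birthWord hW hl i₀ s, killWord hW hl i₀ s)) ?_ ?_ codes.finite_toSet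
    · rintro s ⟨hs, hm, hmax⟩
      obtain ⟨c, hc⟩ := exists_codedSegment_eq hW hs i₀
      exact Finset.mem_product.2 ⟨Finset.mem_image.2 ⟨c, Finset.mem_univ c, hc⟩,
        Finset.mem_product.2 ⟨birthWord_mem_birthWords hW hl i₀ hs hmax hm.ge,
          killWord_mem_killWords hW hl i₀ hs⟩⟩
    · rintro s ⟨hs, -⟩ s' ⟨hs', -⟩ heq
      obtain ⟨h₀, hbirth, hkill⟩ := by simpa only [Prod.mk.injEq] using heq
      exact eq_of_words_eq hW hl i₀ hs hs' h₀ hbirth hkill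
  refine hcodes.trans ?_
  rw [Finset.card_product, Finset.card_product]
  gcongr

theorem ncard_tessTuplesMaxHit_le (hW : Convex ℝ W)
    (hl : Pairwise fun i j => Nonparallel (l i) (l j)) (i₀ : Fin k) (m : ℕ) :
    ((tessTuplesMaxHit W l i₀ m).ncard : ℝ) ≤
      (k + 1) ^ 2 * ((256 * (m + 1)) ^ k / (m + 1) ^ m) := by
  have hbirth : ((birthWords (Fin k × ℤˣ) m (k + m)).card : ℝ) ≤
      (16 * (m + 1)) ^ k / (m + 1) ^ m := by
    have h := card_birthWords_mul_le (ι := Fin k × ℤˣ) m (k + m)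
    simp only [Fintype.card_prod, Fintype.card_fin, Fintype.card_units_int] at h
    rw [le_div_iff₀ (by positivity)]
    refine le_of_mul_le_mul_right ?_ (show (0 : ℝ) < (m + 1) ^ k by positivity)
    calc _ = ((birthWords (Fin k × ℤˣ) m (k + m)).card : ℝ) * (m + 1) ^ (k + m) := by ring
      _ ≤ (4 * (m + 1)) ^ (k * 2) := h
      _ = (16 * (m + 1)) ^ k * (m + 1) ^ k := by
        rw [mul_comm k, pow_mul, ← mul_pow]
        ring_nf
  have hkill : ((killWords (Fin k × ℤˣ)).card : ℝ) ≤ 16 ^ k := by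
    refine (card_killWords_le (Fin k × ℤˣ)).trans_eq ?_
    rw [Fintype.card_prod, Fintype.card_fin, Fintype.card_units_int, mul_comm k, pow_mul]
    norm_num
  calc ((tessTuplesMaxHit W l i₀ m).ncard : ℝ)
      ≤ (k + 1) ^ 2 *
        ((birthWords (Fin k × ℤˣ) m (k + m)).card * (killWords (Fin k × ℤˣ)).card) := by
        exact_mod_cast ncard_tessTuplesMaxHit_le_card hW hl i₀ m
    _ ≤ (k + 1) ^ 2 * ((16 * (m + 1)) ^ k / (m + 1) ^ m * 16 ^ k) := by gcongr
    _ = (k + 1) ^ 2 * ((256 * (m + 1)) ^ k / (m + 1) ^ m) := by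
        rw [div_mul_eq_mul_div, ← mul_pow]
        ring_nf

theorem tessTuples_subset_iUnion_tessTuplesMaxHit [Nonempty (Fin k)] :
    tessTuples W l ⊆ ⋃ p ∈ (Finset.univ : Finset (Fin k)) ×ˢ Finset.range (k + 1),
      tessTuplesMaxHit W l p.1 p.2 := fun s hs => by
  obtain ⟨i₀, hi₀⟩ := Finite.exists_max fun i => (hitSegments l s i).card
  have hcard : (hitSegments l s i₀).card ≤ k :=
    (Finset.card_le_univ _).trans_eq (Fintype.card_fin k)
  exact Set.mem_biUnion (x := (i₀, (hitSegments l s i₀).card))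
    (by simpa [Nat.lt_succ_iff] using hcard) ⟨hs, rfl, hi₀⟩

theorem ncard_tessTuples_le (hW : Convex ℝ W) (hl : Pairwise fun i j => Nonparallel (l i) (l j)) :
    ((tessTuples W l).ncard : ℝ) ≤
      ∑ m ∈ Finset.range (k + 1), (2048 * (m + 1) : ℝ) ^ k / (m + 1) ^ m := by
  rcases k.eq_zero_or_pos with rfl | hk
  · have h : (tessTuples W l).ncard ≤ 1 := Set.ncard_le_one_of_subsingleton _
    simpa using h
  have : Nonempty (Fin k) := ⟨⟨0, hk⟩⟩
  have hunion : (tessTuples W l).ncard ≤ ∑ i₀, ∑ m ∈ Finset.range (k + 1),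
      (tessTuplesMaxHit W l i₀ m).ncard := by
    rw [← Finset.sum_product']
    exact (Set.ncard_le_ncard tessTuples_subset_iUnion_tessTuplesMaxHit
      ((Finset.finite_toSet _).biUnion fun p _ =>
        (finite_tessTuples hW l).subset fun s hs => hs.1)).trans (Finset.set_ncard_biUnion_le _ _)
  have hpow : (k : ℝ) * (k + 1) ^ 2 ≤ 8 ^ k := by
    have h2 : (k : ℝ) + 1 ≤ 2 ^ k := by exact_mod_cast Nat.lt_two_pow_self (n := k)
    calc (k : ℝ) * (k + 1) ^ 2 ≤ 2 ^ k * (2 ^ k) ^ 2 := by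
          gcongr
          linarith
      _ = 8 ^ k := by
          rw [← pow_succ', ← pow_mul, mul_comm k, pow_mul]
          norm_num
  calc ((tessTuples W l).ncard : ℝ)
      ≤ ∑ i₀, ∑ m ∈ Finset.range (k + 1), ((tessTuplesMaxHit W l i₀ m).ncard : ℝ) := by
        exact_mod_cast hunion
    _ ≤ ∑ _i₀ : Fin k, ∑ m ∈ Finset.range (k + 1),
          (k + 1) ^ 2 * ((256 * (m + 1) : ℝ) ^ k / (m + 1) ^ m) := by
        gcongr
        exact ncard_tessTuplesMaxHit_le hW hl _ _
    _ = ∑ m ∈ Finset.range (k + 1),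
          k * (k + 1) ^ 2 * ((256 * (m + 1) : ℝ) ^ k / (m + 1) ^ m) := by
        simp only [Finset.sum_const, Finset.card_univ, Fintype.card_fin, nsmul_eq_mul,
          Finset.mul_sum, mul_assoc]
    _ ≤ ∑ m ∈ Finset.range (k + 1), 8 ^ k * ((256 * (m + 1) : ℝ) ^ k / (m + 1) ^ m) := by gcongr
    _ = ∑ m ∈ Finset.range (k + 1), (2048 * (m + 1) : ℝ) ^ k / (m + 1) ^ m := by
        refine Finset.sum_congr rfl fun m _ => ?_
        rw [← mul_div_assoc, ← mul_pow]
        ring_nf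

end Count

/-! ### The Gibbs measure -/

theorem ae_pi_pairwise {α : Type*} [MeasurableSpace α] {μ : Measure α} [SigmaFinite μ]
    {r : α → α → Prop} (hr : MeasurableSet {p : α × α | r p.1 p.2})
    (hae : ∀ᵐ a ∂μ, ∀ᵐ b ∂μ, r a b) (k : ℕ) :
    ∀ᵐ l ∂Measure.pi fun _ : Fin k => μ, Pairwise fun i j => r (l i) (l j) := by
  rcases k with - | k
  · exact .of_forall fun l i => i.elim0
  have hfst : ∀ᵐ p ∂μ.prod (Measure.pi fun _ : Fin k => μ), ∀ j, r p.1 (p.2 j) := by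
    refine ae_all_iff.2 fun j => (Measure.ae_prod_iff_ae_ae ?_).2 (hae.mono fun a ha =>
      (Measure.quasiMeasurePreserving_eval (fun _ : Fin k => μ) j).ae ha)
    exact hr.preimage (f := fun p : α × (Fin k → α) => (p.1, p.2 j)) (by fun_prop)
  have hall : ∀ᵐ l ∂Measure.pi fun _ : Fin (k + 1) => μ, ∀ i j, r (l i) (l (i.succAbove j)) :=
    ae_all_iff.2 fun i =>
      (measurePreserving_piFinSuccAbove (fun _ => μ) i).quasiMeasurePreserving.ae hfst
  refine hall.mono fun l h i j hij => ?_
  obtain ⟨j, rfl⟩ := Fin.exists_succAbove_eq hij.symm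
  exact h i j

theorem measurableSet_nonparallel :
    MeasurableSet {p : LineParam × LineParam | Nonparallel p.1 p.2} := by
  have h : Measurable fun p : LineParam × LineParam => Real.sin (p.1.1 - p.2.1) := by fun_prop
  exact (h (measurableSet_singleton 0)).compl

theorem ae_nonparallel (l : LineParam) : ∀ᵐ m : LineParam, Nonparallel l m := by
  have hangle : {α : ℝ | Real.sin (l.1 - α) = 0}.Countable := by
    refine (Set.countable_range fun n : ℤ => l.1 - n * Real.pi).mono fun α hα => ?_
    obtain ⟨n, hn⟩ := Real.sin_eq_zero_iff.1 hα
    exact ⟨n, by linarith⟩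
  exact Measure.quasiMeasurePreserving_fst.ae (hangle.ae_notMem volume)

theorem lintegral_tessellationsOn {W : Set Plane} {f : TTessellation W → ℝ≥0∞} (hf : Measurable f)
    (L : FinConfig LineParam) :
    ∫⁻ T, f T ∂tessellationsOn W L = ∑' T : {T : TTessellation W // T.lines = L}, f T := by
  rw [tessellationsOn, lintegral_sum_measure]
  exact tsum_congr fun T => lintegral_dirac' _ hf

theorem measurable_tsum_tessellations {W : Set Plane} (hW : Convex ℝ W)
    {f : TTessellation W → ℝ≥0∞} (hf : Measurable f) :
    Measurable fun L => ∑' T : {T : TTessellation W // T.lines = L}, f T := by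
  simp only [← lintegral_tessellationsOn hf]
  exact (Measure.measurable_lintegral hf).comp (measurable_tessellationsOn hW)

theorem gibbsMeasure_apply {W : Set Plane} (hW : Convex ℝ W) (τ : ℝ≥0) {H : TTessellation W → ℝ}
    (hH : Measurable H) {A : Set (TTessellation W)} (hA : MeasurableSet A) :
    gibbsMeasure W τ H A = ∫⁻ L, ∑' T : {T : TTessellation W // T.lines = L},
      A.indicator (fun T => ENNReal.ofReal (Real.exp (-H T))) T.1 ∂(poissonLines W τ) := by
  have hf : Measurable (A.indicator fun T => ENNReal.ofReal (Real.exp (-H T))) :=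
    hH.neg.exp.ennreal_ofReal.indicator hA
  rw [gibbsMeasure, withDensity_apply _ hA, ← lintegral_indicator hA, tessellationMeasure,
    Measure.lintegral_bind (measurable_tessellationsOn hW).aemeasurable hf.aemeasurable]
  exact lintegral_congr fun L => lintegral_tessellationsOn hf L

theorem card_points_ofTuple_le {α : Type*} {k : ℕ} (x : Fin k → α) :
    (FinConfig.ofTuple x).points.card ≤ k := by
  classical exact Finset.card_image_le.trans_eq (Finset.card_fin k)

theorem exp_neg_energy_le {W : Set Plane} {C : ℝ} {H : TTessellation W → ℝ}
    (hC : ∀ T : TTessellation W, -C * (T.lines.points.card : ℝ) ≤ H T) {k : ℕ}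
    {l : Fin k → LineParam} {T : TTessellation W} (hT : T.lines = FinConfig.ofTuple l) :
    Real.exp (-H T) ≤ Real.exp |C| ^ k := by
  have hcard : (T.lines.points.card : ℝ) ≤ k := by
    exact_mod_cast hT ▸ card_points_ofTuple_le l
  rw [← Real.exp_nat_mul, Real.exp_le_exp]
  calc -H T ≤ C * T.lines.points.card := by linarith [hC T]
    _ ≤ |C| * T.lines.points.card := by
      gcongr
      exact le_abs_self C
    _ ≤ |C| * k := by gcongr
    _ = k * |C| := mul_comm _ _

theorem tsum_exp_neg_energy_le {W : Set Plane} (hW : Convex ℝ W) {C : ℝ} {H : TTessellation W → ℝ}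
    (hC : ∀ T : TTessellation W, -C * (T.lines.points.card : ℝ) ≤ H T) {k : ℕ}
    {l : Fin k → LineParam} (hl : Pairwise fun i j => Nonparallel (l i) (l j)) :
    ∑' T : {T : TTessellation W // T.lines = FinConfig.ofTuple l},
        ENNReal.ofReal (Real.exp (-H T)) ≤
      ENNReal.ofReal
        (∑ m ∈ Finset.range (k + 1), (Real.exp |C| * 2048 * (m + 1)) ^ k / (m + 1) ^ m) := by
  calc ∑' T : {T : TTessellation W // T.lines = FinConfig.ofTuple l},
        ENNReal.ofReal (Real.exp (-H T))
      ≤ ∑' _T : {T : TTessellation W // T.lines = FinConfig.ofTuple l},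
        ENNReal.ofReal (Real.exp |C| ^ k) :=
        ENNReal.tsum_le_tsum fun T => ENNReal.ofReal_le_ofReal (exp_neg_energy_le hC T.2)
    _ = ∑' _s : tessTuples W l, ENNReal.ofReal (Real.exp |C| ^ k) :=
        ((tessTuplesEquiv W l).tsum_eq fun _ => ENNReal.ofReal (Real.exp |C| ^ k)).symm
    _ = ENNReal.ofReal (Real.exp |C| ^ k * (tessTuples W l).ncard) := by
        rw [ENNReal.tsum_set_const, ← (finite_tessTuples hW l).cast_ncard_eq,
          ENNReal.ofReal_mul (by positivity), mul_comm]
        simp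
    _ ≤ ENNReal.ofReal (Real.exp |C| ^ k *
          ∑ m ∈ Finset.range (k + 1), (2048 * (m + 1) : ℝ) ^ k / (m + 1) ^ m) := by
        gcongr
        exact ncard_tessTuples_le hW hl
    _ = _ := by
        simp only [Finset.mul_sum, ← mul_div_assoc, ← mul_pow, mul_assoc]

theorem lintegral_poissonLines_le (W : Set Plane) (τ : ℝ≥0) {F : FinConfig LineParam → ℝ≥0∞}
    (hF : Measurable F) {c : ℕ → ℝ≥0∞}
    (hFc : ∀ k, ∀ l : Fin k → LineParam, (Pairwise fun i j => Nonparallel (l i) (l j)) →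
      F (FinConfig.ofTuple l) ≤ c k) :
    ∫⁻ L, F L ∂poissonLines W τ ≤ ∑' k, ProbabilityTheory.poissonMeasure τ {k} * c k := by
  set μ := ProbabilityTheory.cond (volume : Measure LineParam) (hittingLines W)
  rw [poissonLines, lintegral_sum_measure]
  refine ENNReal.tsum_le_tsum fun k => ?_
  have hgeneric : ∀ᵐ l ∂Measure.pi fun _ : Fin k => μ,
      Pairwise fun i j => Nonparallel (l i) (l j) :=
    ae_pi_pairwise measurableSet_nonparallel (.of_forall fun l =>
      ProbabilityTheory.cond_absolutelyContinuous.ae_le (ae_nonparallel l)) k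
  have hmass : (Measure.pi fun _ : Fin k => μ) Set.univ ≤ 1 := by
    rw [Measure.pi_univ]
    exact Finset.prod_le_one' fun _ _ => prob_le_one
  rw [lintegral_smul_measure, lintegral_map hF (FinConfig.measurable_ofTuple k), smul_eq_mul]
  gcongr
  calc ∫⁻ l, F (FinConfig.ofTuple l) ∂(Measure.pi fun _ : Fin k => μ)
      ≤ ∫⁻ _, c k ∂(Measure.pi fun _ : Fin k => μ) := lintegral_mono_ae (hgeneric.mono (hFc k))
    _ ≤ c k := by
        rw [lintegral_const]
        exact mul_le_of_le_one_right' hmass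

theorem summable_exp_div_pow (K : ℝ) :
    Summable fun m : ℕ => Real.exp (K * (m + 1)) / (m + 1 : ℝ) ^ m := by
  refine ((Real.summable_pow_div_factorial (Real.exp K)).mul_left (Real.exp K)).of_nonneg_of_le
    (fun m => by positivity) fun m => ?_
  have hfactorial : (m.factorial : ℝ) ≤ (m + 1) ^ m := by
    exact_mod_cast (Nat.factorial_le_pow m).trans (Nat.pow_le_pow_left m.le_succ m)
  calc Real.exp (K * (m + 1)) / (m + 1 : ℝ) ^ m ≤ Real.exp (K * (m + 1)) / m.factorial := by gcongr
    _ = Real.exp K * (Real.exp K ^ m / m.factorial) := by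
      rw [mul_add_one, Real.exp_add, mul_comm K, Real.exp_nat_mul]
      ring

theorem tsum_poissonMeasure_mul_lt_top (τ : ℝ≥0) {K : ℝ} (hK : 0 ≤ K) :
    ∑' k, ProbabilityTheory.poissonMeasure τ {k} * ENNReal.ofReal
      (∑ m ∈ Finset.range (k + 1), (K * (m + 1)) ^ k / (m + 1) ^ m) < ∞ := by
  have hterm : ∀ k, ProbabilityTheory.poissonMeasure τ {k} * ENNReal.ofReal
      (∑ m ∈ Finset.range (k + 1), (K * (m + 1)) ^ k / (m + 1) ^ m) ≤
      ∑' m : ℕ, ENNReal.ofReal ((τ * K * (m + 1)) ^ k / k.factorial / (m + 1) ^ m) := fun k => by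
    have hpoisson : ProbabilityTheory.poissonMeasure τ {k} ≤
        ENNReal.ofReal ((τ : ℝ) ^ k / k.factorial) := by
      rw [ProbabilityTheory.poissonMeasure_singleton, mul_div_assoc]
      exact ENNReal.ofReal_le_ofReal <|
        mul_le_of_le_one_left (by positivity) (Real.exp_le_one_iff.2 (by simp))
    refine (mul_le_mul_left hpoisson _).trans
      (Eq.trans_le ?_ (ENNReal.sum_le_tsum (Finset.range (k + 1))))
    rw [← ENNReal.ofReal_mul (by positivity), Finset.mul_sum,
      ENNReal.ofReal_sum_of_nonneg fun m _ => by positivity]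
    refine Finset.sum_congr rfl fun m _ => congrArg _ ?_
    simp only [mul_pow]
    ring
  have hexp : ∀ m : ℕ,
      ∑' k : ℕ, ENNReal.ofReal ((τ * K * (m + 1)) ^ k / k.factorial / (m + 1) ^ m) =
        ENNReal.ofReal (Real.exp (τ * K * (m + 1)) / (m + 1) ^ m) := fun m => by
    have h := (NormedSpace.expSeries_div_hasSum_exp (τ * K * (m + 1))).div_const ((m + 1 : ℝ) ^ m)
    rw [← ENNReal.ofReal_tsum_of_nonneg (fun k => by positivity) h.summable, h.tsum_eq,
      Real.exp_eq_exp_ℝ]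
  refine (ENNReal.tsum_le_tsum hterm).trans_lt ?_
  rw [ENNReal.tsum_comm]
  simp only [hexp]
  exact (summable_exp_div_pow (τ * K)).tsum_ofReal_lt_top

theorem mainTheorem2 (W : Set Plane) (hW_convex : Convex ℝ W) (hW_bounded : Bornology.IsBounded W)
    (hW_int : (interior W).Nonempty) (C : ℝ) (H : TTessellation W → ℝ) (hH : Measurable H)
    (hC : ∀ T : TTessellation W, -C * (T.lines.points.card : ℝ) ≤ H T) (τ : ℝ≥0) :
    AEMeasurable (tessellationsOn W) (poissonLines W τ) ∧
      (∀ A : Set (TTessellation W), MeasurableSet A →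
        gibbsMeasure W τ H A =
          ∫⁻ L, ∑' T : {T : TTessellation W // T.lines = L},
            A.indicator (fun T => ENNReal.ofReal (Real.exp (-H T))) T.1 ∂(poissonLines W τ)) ∧
      IsFiniteMeasure (gibbsMeasure W τ H) := by
  refine ⟨(measurable_tessellationsOn hW_convex).aemeasurable,
    fun A hA => gibbsMeasure_apply hW_convex τ hH hA, ⟨?_⟩⟩
  rw [gibbsMeasure_apply hW_convex τ hH MeasurableSet.univ]
  simp only [Set.indicator_univ]
  exact (lintegral_poissonLines_le W τ
    (measurable_tsum_tessellations hW_convex hH.neg.exp.ennreal_ofReal)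
    fun k l hl => tsum_exp_neg_energy_le hW_convex hC hl).trans_lt
    (tsum_poissonMeasure_mul_lt_top τ (by positivity))
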